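/- Let $\Sigma=\{0,\dots,d-1\}$ with $d\ge 1$. A substitution is a non-erasing morphism of $\Sigma^*$; it also acts on the set $\Sigma^\omega$ of infinite words. For $i\in\Sigma$ let $\lambda_i,\rho_i$ be the substitutions with $\lambda_i(i)=\rho_i(i)=i$ and $\lambda_i(j)=ij$, $\rho_i(j)=ji$ for $j\neq i$, and let $S=\{\lambda_0,\dots,\lambda_{d-1},\rho_0,\dots,\rho_{d-1}\}$. A sequence $s=(\sigma_n)_{n\in\mathbb N}\in S^\omega$ is weakly primitive if for every $n$ there is $m\ge n$ such that every letter occurs in $\sigma_n\cdots\sigma_m(c)$ for every letter $c$. A substitution is left-proper if the images of all letters begin with the same letter. The sequence $s$ directs $\alpha\in\Sigma^\omega$ if there are infinite words $\alpha^{(0)}=\alpha,\alpha^{(1)},\alpha^{(2)},\dots$ over $\Sigma$ with $\sigma_n(\alpha^{(n+1)})=\alpha^{(n)}$ for all $n$. A word $\alpha\in\Sigma^\omega$ is Arnoux-Rauzy if it is directed by some weakly primitive $s\in S^\omega$ with infinitely many left-proper terms. Theorem. Every weakly primitive $s\in S^\omega$ with infinitely many left-proper terms directs exactly one Arnoux-Rauzy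 word. Moreover, there is an algorithm that, given $d$ and a Büchi automaton recognising an $\omega$-regular language $L\subseteq\Sigma^\omega$, computes a Büchi automaton $\mathcal C$ over the alphabet $S$ (with $\lambda_i$ and $\rho_i$ written as $2d$ separate symbols) that accepts $s\in S^\omega$ if and only if $s$ is weakly primitive, contains infinitely many left-proper terms, and the unique Arnoux-Rauzy word directed by $s$ is in $L$. -/

import Mathlib

open Filter

/-! ### Büchi automata and their finite presentations -/

/-- A nondeterministic Büchi automaton over the alphabet `Γ` with state set `Q`
(finiteness of `Q` is imposed where the notion is used). -/
structure BuchiAutomaton (Γ Q : Type) where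
  /-- initial states -/
  init : Set Q
  /-- transition relation -/
  trans : Set (Q × Γ × Q)
  /-- accepting states -/
  final : Set Q

/-- `B` accepts the infinite word `α`: there is a run on `α` that starts in an initial state and
visits accepting states infinitely often. -/
def BuchiAutomaton.Accepts {Γ Q : Type} (B : BuchiAutomaton Γ Q) (α : ℕ → Γ) : Prop :=
  ∃ r : ℕ → Q, r 0 ∈ B.init ∧ (∀ n, (r n, α n, r (n + 1)) ∈ B.trans) ∧
    ∃ᶠ n in atTop, r n ∈ B.final

/-- The language of infinite words accepted by `B`. -/
def BuchiAutomaton.language {Γ Q : Type} (B : BuchiAutomaton Γ Q) : Set (ℕ → Γ) :=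
  {α | B.Accepts α}

/-- A language of infinite words is ω-regular if it is the language of a Büchi automaton with
finitely many states. -/
def IsOmegaRegular {Γ : Type} (L : Set (ℕ → Γ)) : Prop :=
  ∃ (Q : Type) (_ : Finite Q) (B : BuchiAutomaton Γ Q), B.language = L

/-- Finite presentations of Büchi automata, on which algorithms operate:
`(number of states, (initial states, (transitions, accepting states)))`, where states and
letters are written as natural numbers and a transition is a triple
`(source, (letter, target))`. -/
abbrev BuchiCode : Type := ℕ × List ℕ × List (ℕ × ℕ × ℕ) × List ℕ

/-- The Büchi automaton with state set `{0, …, A.1 - 1}` presented by `A`, over an alphabet `Γ`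
whose letters are numbered by `num`. -/
def BuchiCode.toBuchi (A : BuchiCode) {Γ : Type} (num : Γ → ℕ) :
    BuchiAutomaton Γ (Fin A.1) where
  init := {q | (q : ℕ) ∈ A.2.1}
  trans := {t | ((t.1 : ℕ), num t.2.1, (t.2.2 : ℕ)) ∈ A.2.2.1}
  final := {q | (q : ℕ) ∈ A.2.2.2}

/-- The languages presented by codes are exactly the ω-regular languages. -/
theorem isOmegaRegular_iff_exists_code {d : ℕ} (L : Set (ℕ → Fin d)) :
    IsOmegaRegular L ↔
      ∃ A : BuchiCode, (A.toBuchi (fun i : Fin d => (i : ℕ))).language = L := by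
  classical
  constructor
  · rintro ⟨Q, hQ, B, rfl⟩
    obtain ⟨k, ⟨e⟩⟩ := Finite.exists_equiv_fin Q
    have listOf : ∀ {T : Type} [Finite T] (g : T → Prop) (h : T → ℕ × ℕ × ℕ),
        ∃ l : List (ℕ × ℕ × ℕ), ∀ x, x ∈ l ↔ ∃ t, g t ∧ h t = x := by
      intro T _ g h
      refine ⟨((Set.toFinite (h '' {t | g t})).toFinset).toList, fun x => ?_⟩
      simp
    have listOf' : ∀ (g : Q → Prop), ∃ l : List ℕ, ∀ x, x ∈ l ↔ ∃ t, g t ∧ (e t : ℕ) = x := by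
      intro g
      refine ⟨((Set.toFinite ((fun t => (e t : ℕ)) '' {t | g t})).toFinset).toList, fun x => ?_⟩
      simp
    obtain ⟨li, hi⟩ := listOf' (fun q => q ∈ B.init)
    obtain ⟨lf, hf⟩ := listOf' (fun q => q ∈ B.final)
    obtain ⟨lt, ht⟩ := listOf (T := Q × Fin d × Q) (fun t => t ∈ B.trans)
      (fun t => ((e t.1 : ℕ), (t.2.1 : ℕ), (e t.2.2 : ℕ)))
    have key : ∀ (g : Q → Prop) (l : List ℕ), (∀ x, x ∈ l ↔ ∃ t, g t ∧ (e t : ℕ) = x) →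
        ∀ q : Fin k, (q : ℕ) ∈ l ↔ g (e.symm q) := by
      intro g l hl q
      rw [hl]
      constructor
      · rintro ⟨t, h1, h2⟩
        have h3 : e t = q := Fin.ext h2
        rw [← h3]
        simpa using h1
      · intro h
        exact ⟨_, h, by simp⟩
    have keyt : ∀ (q q' : Fin k) (a : Fin d), ((q : ℕ), (a : ℕ), (q' : ℕ)) ∈ lt ↔
        (e.symm q, a, e.symm q') ∈ B.trans := by
      intro q q' a
      rw [ht]
      constructor
      · rintro ⟨⟨t1, t2, t3⟩, h1, h2⟩
        simp only [Prod.mk.injEq] at h2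
        have h3 : e t1 = q := Fin.ext h2.1
        have h4 : t2 = a := Fin.ext h2.2.1
        have h5 : e t3 = q' := Fin.ext h2.2.2
        rw [← h3, ← h4, ← h5]
        simpa using h1
      · intro h
        exact ⟨_, h, by simp⟩
    refine ⟨(k, li, lt, lf), ?_⟩
    ext α
    constructor
    · rintro ⟨r, h0, h1, h2⟩
      exact ⟨fun n => e.symm (r n), (key _ _ hi _).1 h0, fun n => (keyt _ _ _).1 (h1 n),
        h2.mono fun n hn => (key _ _ hf _).1 hn⟩
    · rintro ⟨r, h0, h1, h2⟩
      refine ⟨fun n => e (r n), (key _ _ hi _).2 (by simpa using h0),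
        fun n => (keyt _ _ _).2 (by simpa using h1 n),
        h2.mono fun n hn => (key _ _ hf _).2 (by simpa using hn)⟩
  · rintro ⟨A, rfl⟩
    exact ⟨Fin A.1, inferInstance, _, rfl⟩

/-! ### Substitutions -/

/-- A substitution (non-erasing morphism of the free monoid) over `Γ`, given by the images of
the letters. -/
structure Substitution (Γ : Type) where
  /-- the image of a letter -/
  img : Γ → List Γ
  nonerasing : ∀ a, img a ≠ []

namespace Substitution

variable {Γ : Type}

/-- The action on finite words. -/
def onList (σ : Substitution Γ) (u : List Γ) : List Γ := u.flatMap σ.img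

theorem length_le_length_onList (σ : Substitution Γ) (u : List Γ) :
    u.length ≤ (σ.onList u).length := by
  induction u with
  | nil => simp
  | cons a u ih =>
    have h : 0 < (σ.img a).length := List.length_pos_iff.2 (σ.nonerasing a)
    simp only [onList, List.flatMap_cons, List.length_append, List.length_cons] at ih ⊢
    omega

/-- The action on infinite words: the letter of `σ(α)` at position `k` is read off the image of
the prefix of `α` of length `k + 1`, which has length at least `k + 1`. -/
def onInf (σ : Substitution Γ) (α : ℕ → Γ) : ℕ → Γ := fun k =>
  (σ.onList ((List.range (k + 1)).map α))[k]'(by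
    have h := σ.length_le_length_onList ((List.range (k + 1)).map α)
    simp only [List.length_map, List.length_range] at h
    omega)

/-- The composition `σ ∘ τ`. -/
def comp (σ τ : Substitution Γ) : Substitution Γ where
  img a := σ.onList (τ.img a)
  nonerasing a := by
    have h : 0 < (τ.img a).length := List.length_pos_iff.2 (τ.nonerasing a)
    exact List.length_pos_iff.1 (lt_of_lt_of_le h (σ.length_le_length_onList _))

/-- Every letter occurs in the image of every letter. -/
def Positive (σ : Substitution Γ) : Prop := ∀ c b, b ∈ σ.img c

/-- The images of all letters begin with the same letter. -/
def LeftProper (σ : Substitution Γ) : Prop := ∃ b, ∀ a, (σ.img a).head? = some b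

/-- `compFrom s n k` is the composition `s n ∘ s (n + 1) ∘ ⋯ ∘ s (n + k)`. -/
def compFrom (s : ℕ → Substitution Γ) (n : ℕ) : ℕ → Substitution Γ
  | 0 => s n
  | k + 1 => (compFrom s n k).comp (s (n + k + 1))

end Substitution

/-! ### Directive sequences -/

/-- For every `n` some composition `s n ∘ ⋯ ∘ s m` with `m ≥ n` is positive. -/
def WeaklyPrimitive {Γ : Type} (s : ℕ → Substitution Γ) : Prop :=
  ∀ n, ∃ k, (Substitution.compFrom s n k).Positive

/-- Infinitely many terms of `s` are left-proper. -/
def InfinitelyManyLeftProper {Γ : Type} (s : ℕ → Substitution Γ) : Prop :=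
  ∃ᶠ n in atTop, (s n).LeftProper

/-- The sequence `s` directs the infinite word `α`. -/
def Directs {Γ : Type} (s : ℕ → Substitution Γ) (α : ℕ → Γ) : Prop :=
  ∃ a : ℕ → ℕ → Γ, a 0 = α ∧ ∀ n, (s n).onInf (a (n + 1)) = a n

/-! ### Arnoux-Rauzy substitutions and words -/

/-- `λ_i`: maps `i` to `i` and every other letter `j` to `ij`. -/
def lambdaSubst {d : ℕ} (i : Fin d) : Substitution (Fin d) where
  img j := if j = i then [i] else [i, j]
  nonerasing j := by split <;> simp

/-- `ρ_i`: maps `i` to `i` and every other letter `j` to `ji`. -/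
def rhoSubst {d : ℕ} (i : Fin d) : Substitution (Fin d) where
  img j := if j = i then [i] else [j, i]
  nonerasing j := by split <;> simp

/-- The substitutions `λ_0, …, λ_{d-1}, ρ_0, …, ρ_{d-1}`, indexed by `Fin d ⊕ Fin d`. -/
def arSubst {d : ℕ} : Fin d ⊕ Fin d → Substitution (Fin d) :=
  Sum.elim lambdaSubst rhoSubst

/-- The numbering of the alphabet of directive sequences used in presentations of automata:
`λ_i` has number `i` and `ρ_i` has number `d + i`. -/
def arNum {d : ℕ} : Fin d ⊕ Fin d → ℕ :=
  Sum.elim (fun i => (i : ℕ)) (fun i => d + (i : ℕ))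

/-- An infinite word over `{0, …, d-1}` is Arnoux-Rauzy if it is directed by a weakly primitive
sequence of substitutions `λ_i`, `ρ_i` with infinitely many left-proper terms. -/
def IsArnouxRauzy {d : ℕ} (α : ℕ → Fin d) : Prop :=
  ∃ w : ℕ → Fin d ⊕ Fin d, WeaklyPrimitive (fun n => arSubst (w n)) ∧
    InfinitelyManyLeftProper (fun n => arSubst (w n)) ∧ Directs (fun n => arSubst (w n)) α

/-! Existence and uniqueness of the directed word. If `s m` is left-proper, then `s m` of any word
begins with a fixed letter `b`, so every word `s 0 (⋯ (s m x))` begins with `s 0 (⋯ (s (m - 1) b))`.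
When there are at least two letters, weak primitivity makes these images arbitrarily long. Hence the
words `s 0 (⋯ (s m x))` converge to a limit independent of `x`, and the limits taken from every
level form the only possible chain (`exists_common_prefix`, `existsUnique_directs`).

The automaton. Let `a t` be the words of the chain, and let `W t` be the image of the single letter
`a t 0` under the first `t` substitutions. Each `W t` is a prefix of the directed word, and `W (t +
1) = W t ++ V t`, where `V t` is the image, under the same `t` substitutions, of the tail of `s t (a
(t + 1) 0)`. Thus `s t` and one letter determine how `V t` is composed of images of letters. To
follow a run of `A` along `V t` it suffices to know which pairs of states are joined by paths
labelled by the level-`t` images of letters, and whether an accepting state is entered on the way.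
This is finite information, updated from `s t` alone (`levelTrans_succ`). A state therefore stores a
set of such edges, a guess of `a t 0`, and the state of `A` after `W t`. The stored edges need only
be sound, so guessing a subset does no harm. The guessed letters are forced because infinitely many
`λ_i` occur (`eq_head_of_heads`).

For `d ≥ 2`, weak primitivity means that every index occurs infinitely often
(`weaklyPrimitive_arSubst_iff`), and left-proper means being some `λ_i`. Together with infinitely
many marked blocks `V t`, these are `d + 2` recurrence conditions, merged into one Büchi condition
by a cyclic counter. Soundness is `of_liftRun`, completeness is `exists_liftRun`. The case `d = 1`
is treated separately. -/

/-! ### Automata presented by lists of states -/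

/-- Acceptance by a presented automaton in terms of runs of natural numbers. -/
theorem BuchiCode.accepts_iff (A : BuchiCode) {Γ : Type} (num : Γ → ℕ) (w : ℕ → Γ) :
    (A.toBuchi num).Accepts w ↔
      ∃ r : ℕ → ℕ, (∀ n, r n < A.1) ∧ r 0 ∈ A.2.1 ∧
        (∀ n, (r n, num (w n), r (n + 1)) ∈ A.2.2.1) ∧ ∃ᶠ n in atTop, r n ∈ A.2.2.2 := by
  constructor
  · rintro ⟨r, h0, h1, h2⟩
    exact ⟨fun n => r n, fun n => (r n).2, h0, h1, h2⟩
  · rintro ⟨r, hr, h0, h1, h2⟩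
    exact ⟨fun n => ⟨r n, hr n⟩, h0, h1, h2⟩

open Classical in
/-- The presentation of the automaton with the listed states, the letters below `k`, the initial
states `I`, the transitions `T` and the accepting states `F`. -/
noncomputable def listCode {S : Type} [Inhabited S] (l : List S) (k : ℕ) (I F : S → Prop)
    (T : S × ℕ × S → Prop) : BuchiCode :=
  (l.length, (List.range l.length).filter fun i => I (l.getI i),
    (((List.range l.length).flatMap fun i => (List.range k).flatMap fun x =>
      (List.range l.length).map fun j => (i, x, j)).filter
        fun t => T (l.getI t.1, t.2.1, l.getI t.2.2)),
    (List.range l.length).filter fun i => F (l.getI i))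

/-- A run on indices is read as a run on list entries, and conversely an index is chosen for each
entry, so repetitions in `l` are harmless. The default value of `getI` is never used, since all
indices are below the length. -/
theorem listCode_accepts_iff {S : Type} [Inhabited S] (l : List S) (k : ℕ) (I F : S → Prop)
    (T : S × ℕ × S → Prop) {Γ : Type} (num : Γ → ℕ) (hnum : ∀ x, num x < k) (w : ℕ → Γ) :
    ((listCode l k I F T).toBuchi num).Accepts w ↔
      ∃ r : ℕ → S, (∀ n, r n ∈ l) ∧ I (r 0) ∧ (∀ n, T (r n, num (w n), r (n + 1))) ∧
        ∃ᶠ n in atTop, F (r n) := by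
  rw [BuchiCode.accepts_iff]
  simp only [listCode, List.mem_filter, decide_eq_true_eq, List.mem_range, List.mem_flatMap,
    List.mem_map, Prod.mk.injEq]
  constructor
  · rintro ⟨r, hr, h0, h1, h2⟩
    refine ⟨fun n => l.getI (r n), fun n => ?_, h0.2, fun n => (h1 n).2, h2.mono fun n hn => hn.2⟩
    have h := List.getElem_mem (hr n)
    rwa [← List.getI_eq_getElem] at h
  · rintro ⟨r, hr, h0, h1, h2⟩
    choose f hf hfr using fun n => List.getElem_of_mem (hr n)
    have hg : ∀ n, l.getI (f n) = r n := fun n => by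
      rw [List.getI_eq_getElem _ (hf n), hfr]
    refine ⟨f, hf, ⟨hf 0, by rwa [hg]⟩, fun n => ⟨?_, by rw [hg, hg]; exact h1 n⟩,
      h2.mono fun n hn => ⟨hf n, by rwa [hg]⟩⟩
    exact ⟨f n, hf n, num (w n), hnum _, f (n + 1), hf _, rfl, rfl, rfl⟩

/-- The code consists of bounded loops filtered by primitive recursive predicates. The classical
decisions in `listCode` agree with any other decision procedure, so they do not affect
computability. -/
theorem primrec_listCode {P S : Type} [Primcodable P] [Primcodable S] [Inhabited S]
    {l : P → List S} {k : P → ℕ} {I F : P → S → Prop}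
    {T : P → S × ℕ × S → Prop} (hl : Primrec l) (hk : Primrec k)
    (hI : PrimrecPred fun x : P × S => I x.1 x.2) (hF : PrimrecPred fun x : P × S => F x.1 x.2)
    (hT : PrimrecPred fun x : P × S × ℕ × S => T x.1 x.2) :
    Primrec fun p => listCode (l p) (k p) (I p) (F p) (T p) := by
  classical
  have filt : ∀ {α : Type} [Primcodable α] {f : P → List α} {R : P → α → Prop},
      Primrec f → PrimrecPred (fun x : P × α => R x.1 x.2) →
      Primrec fun p => (f p).filter (fun a => R p a) := by
    intro α _ f R hf hR
    have hR' : PrimrecRel fun (a : α) (p : P) => R p a :=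
      hR.comp (Primrec.pair Primrec.snd Primrec.fst)
    exact (hR'.listFilter.comp hf Primrec.id).of_eq fun p => by simp
  have hlen : Primrec fun p => List.range (l p).length :=
    Primrec.list_range.comp (Primrec.list_length.comp hl)
  have sub : ∀ {R : P → S → Prop}, PrimrecPred (fun x : P × S => R x.1 x.2) →
      Primrec fun p => (List.range (l p).length).filter (fun i => R p ((l p).getI i)) := by
    intro R hR
    refine filt hlen (R := fun p i => R p ((l p).getI i)) ?_
    exact hR.comp (Primrec.pair Primrec.fst
      (Primrec.list_getI.comp (hl.comp Primrec.fst) Primrec.snd))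
  unfold listCode
  refine Primrec.pair (Primrec.list_length.comp hl) (Primrec.pair (sub hI)
    (Primrec.pair ?_ (sub hF)))
  refine filt (R := fun p (t : ℕ × ℕ × ℕ) => T p ((l p).getI t.1, t.2.1, (l p).getI t.2.2)) ?_ ?_
  · refine Primrec.list_flatMap hlen (Primrec.list_flatMap
      (Primrec.list_range.comp (hk.comp Primrec.fst)) (Primrec.list_map
        (hlen.comp (Primrec.fst.comp Primrec.fst)) ?_))
    exact Primrec.pair (Primrec.snd.comp (Primrec.fst.comp Primrec.fst))
      (Primrec.pair (Primrec.snd.comp Primrec.fst) Primrec.snd)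
  · refine hT.comp (Primrec.pair Primrec.fst (Primrec.pair
      (Primrec.list_getI.comp (hl.comp Primrec.fst) (Primrec.fst.comp Primrec.snd))
      (Primrec.pair (Primrec.fst.comp (Primrec.snd.comp Primrec.snd))
        (Primrec.list_getI.comp (hl.comp Primrec.fst)
          (Primrec.snd.comp (Primrec.snd.comp Primrec.snd))))))

/-! ### Prefixes of infinite words -/

/-- The finite word `u` is a prefix of the infinite word `x`. -/
def IsPre {Γ : Type} (u : List Γ) (x : ℕ → Γ) : Prop := ∀ k (h : k < u.length), u[k] = x k

namespace Substitution

variable {Γ : Type}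

theorem onList_append (σ : Substitution Γ) (u v : List Γ) :
    σ.onList (u ++ v) = σ.onList u ++ σ.onList v := by
  simp [onList]

theorem onList_prefix (σ : Substitution Γ) {u v : List Γ} (h : u <+: v) :
    σ.onList u <+: σ.onList v := by
  obtain ⟨t, rfl⟩ := h
  rw [onList_append]
  exact List.prefix_append _ _

theorem isPre_onInf (σ : Substitution Γ) {u : List Γ} {x : ℕ → Γ} (h : IsPre u x) :
    IsPre (σ.onList u) (σ.onInf x) := by
  intro k hk
  have hu : u = (List.range u.length).map x := by
    apply List.ext_getElem
    · simp
    · intro i h1 h2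
      simpa using h i h1
  have range_prefix : ∀ m n, m ≤ n → (List.range m).map x <+: (List.range n).map x := by
    intro m n hmn
    obtain ⟨j, rfl⟩ := Nat.exists_eq_add_of_le hmn
    rw [List.range_add, List.map_append]
    exact List.prefix_append _ _
  unfold onInf
  -- `onInf` reads position `k` off the image of the prefix of length `k + 1`. That prefix and `u`
  -- are comparable, hence so are their images.
  rcases le_total (k + 1) u.length with hle | hle
  · have h1 : (List.range (k + 1)).map x <+: u := by
      conv_rhs => rw [hu]
      exact range_prefix _ _ hle
    exact ((σ.onList_prefix h1).getElem _).symm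
  · have h1 : u <+: (List.range (k + 1)).map x := by
      conv_lhs => rw [hu]
      exact range_prefix _ _ hle
    exact (σ.onList_prefix h1).getElem _

theorem onInf_congr (σ : Substitution Γ) {x y : ℕ → Γ} {k : ℕ} (h : ∀ j ≤ k, x j = y j) :
    σ.onInf x k = σ.onInf y k := by
  have : (List.range (k + 1)).map x = (List.range (k + 1)).map y :=
    List.map_congr_left fun j hj => h j (by simp at hj; omega)
  simp only [onInf, this]

theorem isPre_head_onInf (σ : Substitution Γ) (x : ℕ → Γ) {b : Γ}
    (hb : (σ.img (x 0)).head? = some b) : σ.onInf x 0 = b := by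
  have h : IsPre [x 0] x := by
    intro k hk
    obtain rfl : k = 0 := by simpa using hk
    rfl
  have h1 := σ.isPre_onInf h
  obtain ⟨v, hv⟩ : ∃ v, σ.img (x 0) = b :: v := by
    cases hc : σ.img (x 0) with
    | nil => simp [hc] at hb
    | cons c v => simp [hc] at hb; exact ⟨v, by rw [hb]⟩
  have h2 := h1 0 (by simp [onList, hv])
  simpa [onList, hv] using h2.symm

/-- `iterList s t u` is `s 0 (s 1 (⋯ (s (t - 1) u)))`. -/
def iterList (s : ℕ → Substitution Γ) : ℕ → List Γ → List Γ
  | 0, u => u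
  | t + 1, u => iterList s t ((s t).onList u)

/-- `iterInf s t x` is `s 0 (s 1 (⋯ (s (t - 1) x)))`. -/
def iterInf (s : ℕ → Substitution Γ) : ℕ → (ℕ → Γ) → ℕ → Γ
  | 0, x => x
  | t + 1, x => iterInf s t ((s t).onInf x)

theorem iterList_append (s : ℕ → Substitution Γ) (t : ℕ) (u v : List Γ) :
    iterList s t (u ++ v) = iterList s t u ++ iterList s t v := by
  induction t generalizing u v with
  | zero => rfl
  | succ t ih => simp only [iterList, onList_append, ih]

theorem iterList_nil (s : ℕ → Substitution Γ) (t : ℕ) : iterList s t [] = [] := by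
  induction t with
  | zero => rfl
  | succ t ih => exact ih

theorem iterList_eq_flatMap (s : ℕ → Substitution Γ) (t : ℕ) (u : List Γ) :
    iterList s t u = u.flatMap fun a => iterList s t [a] := by
  induction u with
  | nil => simp [iterList_nil]
  | cons a u ih => rw [List.flatMap_cons, ← ih, ← iterList_append]; rfl

theorem iterList_succ_singleton (s : ℕ → Substitution Γ) (t : ℕ) (a : Γ) :
    iterList s (t + 1) [a] = iterList s t ((s t).img a) := by
  simp [iterList, onList]

theorem length_le_length_iterList (s : ℕ → Substitution Γ) (t : ℕ) (u : List Γ) :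
    u.length ≤ (iterList s t u).length := by
  induction t generalizing u with
  | zero => exact le_rfl
  | succ t ih => exact ((s t).length_le_length_onList u).trans (ih _)

theorem iterList_add (s : ℕ → Substitution Γ) (m j : ℕ) (u : List Γ) :
    iterList s (m + j) u = iterList s m (iterList (fun k => s (m + k)) j u) := by
  induction j generalizing u with
  | zero => rfl
  | succ j ih => exact ih _

theorem iterInf_add (s : ℕ → Substitution Γ) (m j : ℕ) (x : ℕ → Γ) :
    iterInf s (m + j) x = iterInf s m (iterInf (fun k => s (m + k)) j x) := by
  induction j generalizing x with
  | zero => rfl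
  | succ j ih => exact ih _

theorem iterInf_succ' (s : ℕ → Substitution Γ) (m : ℕ) (x : ℕ → Γ) :
    iterInf s (m + 1) x = (s 0).onInf (iterInf (fun k => s (k + 1)) m x) := by
  induction m generalizing x with
  | zero => rfl
  | succ m ih => exact ih _

theorem isPre_iterInf (s : ℕ → Substitution Γ) (t : ℕ) {u : List Γ} {x : ℕ → Γ} (h : IsPre u x) :
    IsPre (iterList s t u) (iterInf s t x) := by
  induction t generalizing u x with
  | zero => exact h
  | succ t ih => exact ih ((s t).isPre_onInf h)

theorem onList_comp (σ τ : Substitution Γ) (u : List Γ) :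
    (σ.comp τ).onList u = σ.onList (τ.onList u) := by
  simp only [onList, comp, List.flatMap_assoc]

theorem onList_compFrom (s : ℕ → Substitution Γ) (n k : ℕ) (u : List Γ) :
    (compFrom s n k).onList u = iterList (fun j => s (n + j)) (k + 1) u := by
  induction k generalizing u with
  | zero => rfl
  | succ k ih =>
    rw [compFrom, onList_comp, ih]
    rfl

theorem img_compFrom (s : ℕ → Substitution Γ) (n k : ℕ) (c : Γ) :
    (compFrom s n k).img c = iterList (fun j => s (n + j)) (k + 1) [c] := by
  rw [← onList_compFrom]
  simp [onList]

theorem compFrom_shift (s : ℕ → Substitution Γ) (m n k : ℕ) :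
    compFrom (fun j => s (m + j)) n k = compFrom s (m + n) k := by
  induction k with
  | zero => rfl
  | succ k ih => rw [compFrom, compFrom, ih, show m + n + k + 1 = m + (n + k + 1) by omega]

end Substitution

open Substitution

/-! ### Growth, convergence and the directed word -/

theorem WeaklyPrimitive.shift {Γ : Type} {s : ℕ → Substitution Γ} (h : WeaklyPrimitive s) (m : ℕ) :
    WeaklyPrimitive fun j => s (m + j) := fun n => by
  simpa only [compFrom_shift] using h (m + n)

theorem InfinitelyManyLeftProper.shift {Γ : Type} {s : ℕ → Substitution Γ}
    (h : InfinitelyManyLeftProper s) (m : ℕ) : InfinitelyManyLeftProper fun j => s (m + j) := by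
  unfold InfinitelyManyLeftProper at *
  rw [Filter.frequently_atTop] at *
  intro a
  obtain ⟨b, hb, hs⟩ := h (m + a)
  obtain ⟨j, rfl⟩ := Nat.exists_eq_add_of_le hb
  exact ⟨a + j, by omega, by rwa [Nat.add_assoc] at hs⟩

/-- Images under longer and longer compositions of a weakly primitive sequence grow. -/
theorem WeaklyPrimitive.exists_length_le {Γ : Type} [Nontrivial Γ] {s : ℕ → Substitution Γ}
    (h : WeaklyPrimitive s) (k : ℕ) :
    ∃ M, ∀ m ≥ M, ∀ u : List Γ, u ≠ [] → k ≤ (iterList s m u).length := by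
  induction k with
  | zero => exact ⟨0, fun _ _ _ _ => Nat.zero_le _⟩
  | succ k ih =>
    obtain ⟨M, hM⟩ := ih
    obtain ⟨j, hj⟩ := h M
    -- The `j + 1` substitutions starting at `M` put every letter into the image, hence at least two
    -- letters. The outer `M` substitutions stretch the first letter to length `k`, and the rest
    -- contributes at least one more.
    refine ⟨M + (j + 1), fun m hm u hu => ?_⟩
    obtain ⟨i, rfl⟩ := Nat.exists_eq_add_of_le hm
    rw [iterList_add, iterList_add]
    set v := iterList (fun k => s (M + (j + 1) + k)) i u with hv
    have hvne : v ≠ [] := by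
      have := length_le_length_iterList (fun k => s (M + (j + 1) + k)) i u
      rw [← hv] at this
      have hu' := List.length_pos_iff.2 hu
      exact List.length_pos_iff.1 (by omega)
    obtain ⟨c, v', hcv⟩ := List.exists_cons_of_ne_nil hvne
    have hmem : ∀ b, b ∈ iterList (fun k => s (M + k)) (j + 1) v := by
      intro b
      have h1 := hj c b
      rw [img_compFrom] at h1
      rw [hcv, show c :: v' = [c] ++ v' from rfl, iterList_append]
      exact List.mem_append_left _ h1
    obtain ⟨a, b, hab⟩ := exists_pair_ne Γ
    generalize iterList (fun k => s (M + k)) (j + 1) v = z at hmem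
    obtain ⟨x, y, t, rfl⟩ : ∃ x y t, z = x :: y :: t := by
      rcases z with _ | ⟨x, _ | ⟨y, t⟩⟩
      · simpa using hmem a
      · have h1 := hmem a
        have h2 := hmem b
        simp only [List.mem_singleton] at h1 h2
        exact absurd (h1.trans h2.symm) hab
      · exact ⟨x, y, t, rfl⟩
    rw [show x :: y :: t = [x] ++ y :: t from rfl, iterList_append, List.length_append]
    have h1 := hM M le_rfl [x] (by simp)
    have h2 := length_le_length_iterList s M (y :: t)
    simp only [List.length_cons] at h2
    omega

/-- Far-away changes of the argument do not affect the beginning of the image. -/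
theorem exists_common_prefix {Γ : Type} [Nonempty Γ] {s : ℕ → Substitution Γ}
    (h : WeaklyPrimitive s) (h' : InfinitelyManyLeftProper s) (k : ℕ) :
    ∃ M, ∃ u : List Γ, k < u.length ∧ ∀ m ≥ M, ∀ x, IsPre u (iterInf s m x) := by
  -- Over one letter images need not grow, but all infinite words coincide.
  rcases subsingleton_or_nontrivial Γ with hΓ | hΓ
  · obtain ⟨a⟩ := ‹Nonempty Γ›
    exact ⟨0, List.replicate (k + 1) a, by simp, fun _ _ _ _ _ => Subsingleton.elim _ _⟩
  · obtain ⟨M, hM⟩ := h.exists_length_le (k + 1)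
    -- A left-proper term at a position `m ≥ M`: below it every word starts with `b`, and the outer
    -- `m` substitutions make `b` long.
    obtain ⟨m, hm, b, hb⟩ := Filter.frequently_atTop.1 h' M
    refine ⟨m + 1, iterList s m [b], hM m hm _ (by simp), fun n hn x => ?_⟩
    obtain ⟨j, rfl⟩ := Nat.exists_eq_add_of_le hn
    rw [iterInf_add]
    refine isPre_iterInf s m ?_
    intro i hi
    obtain rfl : i = 0 := by simpa using hi
    exact (isPre_head_onInf _ _ (hb _)).symm

theorem eq_iterInf_of_chain {Γ : Type} {s : ℕ → Substitution Γ} {a : ℕ → ℕ → Γ}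
    (ha : ∀ n, (s n).onInf (a (n + 1)) = a n) (m : ℕ) : a 0 = iterInf s m (a m) := by
  induction m with
  | zero => rfl
  | succ m ih => rw [ih, iterInf, ha]

/-- The chain consists of the limits, at each level `n`, of the images of an arbitrary word `x₀`.
Any two chains agree, since their level-zero words share arbitrarily long prefixes. -/
theorem existsUnique_directs {Γ : Type} [Nonempty Γ] {s : ℕ → Substitution Γ}
    (h : WeaklyPrimitive s) (h' : InfinitelyManyLeftProper s) : ∃! α, Directs s α := by
  refine existsUnique_of_exists_of_unique ?_ ?_
  · obtain ⟨x₀⟩ : Nonempty (ℕ → Γ) := inferInstance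
    have hlim : ∀ n k, ∃ c M, ∀ m ≥ M, iterInf (fun j => s (n + j)) m x₀ k = c := by
      intro n k
      obtain ⟨M, u, hk, hu⟩ := exists_common_prefix (h.shift n) (h'.shift n) k
      exact ⟨u[k], M, fun m hm => (hu m hm _ k hk).symm⟩
    choose a M hM using hlim
    refine ⟨a 0, a, rfl, fun n => funext fun k => ?_⟩
    -- Position `k` of an image depends only on positions up to `k` of the argument, so finitely
    -- many stabilisation bounds suffice.
    obtain ⟨m, hm⟩ : ∃ m, (∀ j ≤ k, M (n + 1) j ≤ m) ∧ M n k ≤ m + 1 := by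
      refine ⟨(Finset.range (k + 1)).sup (M (n + 1)) + M n k, fun j hj => ?_, by omega⟩
      have := Finset.le_sup (f := M (n + 1)) (Finset.mem_range.2 (show j < k + 1 by omega))
      omega
    have hs : (fun j => s (n + 1 + j)) = fun j => s (n + (j + 1)) := by
      funext j
      rw [show n + 1 + j = n + (j + 1) by omega]
    calc (s n).onInf (a (n + 1)) k
        = (s n).onInf (iterInf (fun j => s (n + 1 + j)) m x₀) k :=
          onInf_congr _ fun j hj => (hM (n + 1) j m (hm.1 j hj)).symm
      _ = iterInf (fun j => s (n + j)) (m + 1) x₀ k := by rw [iterInf_succ', hs, Nat.add_zero]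
      _ = a n k := hM n k (m + 1) hm.2
  · rintro _ _ ⟨a, rfl, ha⟩ ⟨b, rfl, hb⟩
    funext k
    obtain ⟨M, u, hk, hu⟩ := exists_common_prefix h h' k
    rw [eq_iterInf_of_chain ha M, eq_iterInf_of_chain hb M, ← hu M le_rfl _ k hk,
      ← hu M le_rfl _ k hk]

/-! ### Weak primitivity of sequences of Arnoux-Rauzy substitutions -/

/-- The index `i` of `λ_i` or `ρ_i`. -/
def arIdx {d : ℕ} : Fin d ⊕ Fin d → Fin d := Sum.elim id id

theorem mem_img_arSubst {d : ℕ} (x : Fin d ⊕ Fin d) (a b : Fin d) :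
    b ∈ (arSubst x).img a ↔ b = a ∨ b = arIdx x := by
  rcases x with i | i <;> by_cases h : a = i <;>
    simp [arSubst, lambdaSubst, rhoSubst, arIdx, h, or_comm]

/-- Each substitution keeps the letters of a nonempty word and adds only its own index. -/
theorem mem_iterList_arSubst {d : ℕ} (w : ℕ → Fin d ⊕ Fin d) (t : ℕ) (u : List (Fin d))
    (b : Fin d) : b ∈ iterList (fun n => arSubst (w n)) t u ↔
      b ∈ u ∨ u ≠ [] ∧ ∃ j < t, b = arIdx (w j) := by
  induction t generalizing u with
  | zero => simp [iterList]
  | succ t ih =>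
    have key : ∀ b, b ∈ (arSubst (w t)).onList u ↔ b ∈ u ∨ u ≠ [] ∧ b = arIdx (w t) := by
      intro b
      simp only [onList, List.mem_flatMap, mem_img_arSubst]
      constructor
      · rintro ⟨a, ha, rfl | h⟩
        · exact Or.inl ha
        · exact Or.inr ⟨List.ne_nil_of_mem ha, h⟩
      · rintro (h | ⟨hu, h⟩)
        · exact ⟨b, h, Or.inl rfl⟩
        · obtain ⟨a, ha⟩ := List.exists_mem_of_ne_nil u hu
          exact ⟨a, ha, Or.inr h⟩
    have hne : (arSubst (w t)).onList u ≠ [] ↔ u ≠ [] := by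
      have := (arSubst (w t)).length_le_length_onList u
      rw [← List.length_pos_iff, ← List.length_pos_iff]
      refine ⟨fun h => ?_, fun h => by omega⟩
      rw [List.length_pos_iff]
      rintro rfl
      simp [onList] at h
    rw [iterList, ih, key, hne]
    constructor
    · rintro ((h | ⟨hu, h⟩) | ⟨hu, j, hj, h⟩)
      · exact Or.inl h
      · exact Or.inr ⟨hu, t, by omega, h⟩
      · exact Or.inr ⟨hu, j, by omega, h⟩
    · rintro (h | ⟨hu, j, hj, h⟩)
      · exact Or.inl (Or.inl h)
      · rcases Nat.lt_succ_iff_lt_or_eq.1 hj with hj | rfl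
        · exact Or.inr ⟨hu, j, hj, h⟩
        · exact Or.inl (Or.inr ⟨hu, h⟩)

/-- An index `i` can enter the image of a letter `c ≠ i` only through a substitution of index `i`.
Conversely, a window containing all indices gives a positive composition. -/
theorem weaklyPrimitive_arSubst_iff {d : ℕ} (hd : 2 ≤ d) (w : ℕ → Fin d ⊕ Fin d) :
    WeaklyPrimitive (fun n => arSubst (w n)) ↔ ∀ i, ∃ᶠ n in atTop, arIdx (w n) = i := by
  have hmem : ∀ n k c b, b ∈ (compFrom (fun n => arSubst (w n)) n k).img c ↔
      b = c ∨ ∃ j < k + 1, b = arIdx (w (n + j)) := by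
    intro n k c b
    rw [img_compFrom, mem_iterList_arSubst (fun j => w (n + j))]
    simp
  constructor
  · intro h i
    rw [Filter.frequently_atTop]
    intro n
    obtain ⟨k, hk⟩ := h n
    have : Nontrivial (Fin d) := Fin.nontrivial_iff_two_le.2 hd
    obtain ⟨c, hc⟩ := exists_ne i
    have h1 := (hmem n k c i).1 (hk c i)
    rcases h1 with h1 | ⟨j, -, h1⟩
    · exact absurd h1.symm hc
    · exact ⟨n + j, by omega, h1.symm⟩
  · intro h n
    choose f hf hfi using fun i => Filter.frequently_atTop.1 (h i) n
    refine ⟨Finset.univ.sup f, fun c b => (hmem _ _ _ _).2 (Or.inr ⟨f b - n, ?_, ?_⟩)⟩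
    · have := Finset.le_sup (f := f) (Finset.mem_univ b)
      omega
    · have := hf b
      rw [show n + (f b - n) = f b by omega, hfi]

/-- The image of `a` under `ρ_i` begins with `a` itself, which varies once there are two letters. -/
theorem leftProper_arSubst_iff {d : ℕ} (hd : 2 ≤ d) (x : Fin d ⊕ Fin d) :
    (arSubst x).LeftProper ↔ x.isLeft = true := by
  rcases x with i | i
  · simp only [Sum.isLeft_inl, iff_true]
    refine ⟨i, fun a => ?_⟩
    by_cases h : a = i <;> simp [arSubst, lambdaSubst, h]
  · simp only [Sum.isLeft_inr, Bool.false_eq_true, iff_false]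
    rintro ⟨b, hb⟩
    have : Nontrivial (Fin d) := Fin.nontrivial_iff_two_le.2 hd
    have h : ∀ a, a = b := by
      intro a
      have := hb a
      by_cases h : a = i <;> simpa [arSubst, rhoSubst, h] using this
    obtain ⟨c, hc⟩ := exists_ne b
    exact hc (h c)

/-! ### Paths with marked transitions -/

section Paths

variable {Γ Δ Q : Type}

/-- `RPath T u q q' b`: there is a path labelled `u` from `q` to `q'` along the marked
transitions `T`; the mark `b` tells whether one of its transitions is marked. -/
def RPath (T : Q → Γ → Q → Bool → Prop) : List Γ → Q → Q → Bool → Prop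
  | [], q, q', b => q = q' ∧ b = false
  | a :: u, q, q', b => ∃ p b₁ b₂, T q a p b₁ ∧ RPath T u p q' b₂ ∧ b = (b₁ || b₂)

theorem rpath_append (T : Q → Γ → Q → Bool → Prop) (u v : List Γ) (q q' : Q) (b : Bool) :
    RPath T (u ++ v) q q' b ↔
      ∃ p b₁ b₂, RPath T u q p b₁ ∧ RPath T v p q' b₂ ∧ b = (b₁ || b₂) := by
  induction u generalizing q b with
  | nil =>
    constructor
    · intro h
      exact ⟨q, false, b, ⟨rfl, rfl⟩, h, rfl⟩
    · rintro ⟨p, _, b₂, ⟨rfl, rfl⟩, h, rfl⟩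
      exact h
  | cons a u ih =>
    simp only [List.cons_append, RPath, ih]
    constructor
    · rintro ⟨p, b₁, _, h, ⟨p', b₂, b₃, h', h'', rfl⟩, rfl⟩
      exact ⟨p', _, b₃, ⟨p, b₁, b₂, h, h', rfl⟩, h'', by rw [Bool.or_assoc]⟩
    · rintro ⟨p', _, b₃, ⟨p, b₁, b₂, h, h', rfl⟩, h'', rfl⟩
      exact ⟨p, b₁, _, h, ⟨p', b₂, b₃, h', h'', rfl⟩, by rw [Bool.or_assoc]⟩

theorem rpath_flatMap (T : Q → Γ → Q → Bool → Prop) (F : Δ → List Γ) (u : List Δ) (q q' : Q)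
    (b : Bool) : RPath T (u.flatMap F) q q' b ↔ RPath (fun q a => RPath T (F a) q) u q q' b := by
  induction u generalizing q b with
  | nil => rfl
  | cons a u ih => simp only [List.flatMap_cons, rpath_append, RPath, ih]

theorem rpath_map (T : Q → Γ → Q → Bool → Prop) (f : Δ → Γ) (u : List Δ) (q q' : Q)
    (b : Bool) : RPath T (u.map f) q q' b ↔ RPath (fun q a => T q (f a)) u q q' b := by
  induction u generalizing q b with
  | nil => rfl
  | cons a u ih => simp only [List.map_cons, RPath, ih]

theorem RPath.mono {T T' : Q → Γ → Q → Bool → Prop} {u : List Γ}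
    (hT : ∀ q a q' b, T q a q' b → T' q a q' b) {q q' : Q} {b : Bool}
    (h : RPath T u q q' b) : RPath T' u q q' b := by
  induction u generalizing q b with
  | nil => exact h
  | cons a u ih =>
    obtain ⟨p, b₁, b₂, h1, h2, rfl⟩ := h
    exact ⟨p, b₁, b₂, hT _ _ _ _ h1, ih h2, rfl⟩

theorem RPath.exists_run {T : Q → Γ → Q → Bool → Prop} {u : List Γ} {q q' : Q} {b : Bool}
    (h : RPath T u q q' b) : ∃ (r : ℕ → Q) (β : ℕ → Bool), r 0 = q ∧ r u.length = q' ∧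
      (∀ k (hk : k < u.length), T (r k) u[k] (r (k + 1)) (β k)) ∧
      (b = true → ∃ k < u.length, β k = true) := by
  induction u generalizing q b with
  | nil =>
    obtain ⟨rfl, rfl⟩ := h
    exact ⟨fun _ => q, fun _ => false, rfl, rfl, by simp, by simp⟩
  | cons a u ih =>
    obtain ⟨p, b₁, b₂, h1, h2, rfl⟩ := h
    obtain ⟨r, β, r0, r1, hr, hb⟩ := ih h2
    refine ⟨fun k => Nat.casesOn k q r, fun k => Nat.casesOn k b₁ β, rfl, r1, ?_, ?_⟩
    · rintro (_ | k) hk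
      · simpa [r0] using h1
      · exact hr k (by simpa using hk)
    · intro hb'
      rcases Bool.or_eq_true_iff.1 hb' with hb' | hb'
      · exact ⟨0, by simp, hb'⟩
      · obtain ⟨k, hk, hk'⟩ := hb hb'
        exact ⟨k + 1, by simpa using hk, hk'⟩

theorem exists_rpath_of_run {T : Q → Γ → Q → Bool → Prop} {r : ℕ → Q} {β : ℕ → Bool}
    (u : List Γ) (x : ℕ)
    (h : ∀ k (hk : k < u.length), T (r (x + k)) u[k] (r (x + k + 1)) (β (x + k))) :
    ∃ b, RPath T u (r x) (r (x + u.length)) b ∧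
      ((∃ k < u.length, β (x + k) = true) → b = true) := by
  induction u generalizing x with
  | nil => exact ⟨false, ⟨rfl, rfl⟩, by simp⟩
  | cons a u ih =>
    obtain ⟨b, hb, hb'⟩ := ih (x + 1) fun k hk => by
      have := h (k + 1) (by simpa using hk)
      rwa [show x + (k + 1) = x + 1 + k by omega] at this
    refine ⟨β x || b, ⟨r (x + 1), β x, b, h 0 (by simp), ?_, rfl⟩, ?_⟩
    · rwa [List.length_cons, show x + (u.length + 1) = x + 1 + u.length by omega]
    · rintro ⟨_ | k, hk, hk'⟩
      · simp_all
      · rw [Bool.or_eq_true_iff]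
        refine Or.inr (hb' ⟨k, by simpa using hk, ?_⟩)
        rwa [show x + 1 + k = x + (k + 1) by omega]

/-- Finite paths along consecutive blocks of an infinite word combine to an infinite run. -/
theorem exists_run_of_rpaths {T : Q → Γ → Q → Bool → Prop} {W V : ℕ → List Γ} {α : ℕ → Γ}
    {q : ℕ → Q} {b : ℕ → Bool} (hW0 : W 0 = []) (hW : ∀ t, W (t + 1) = W t ++ V t)
    (hα : ∀ t, IsPre (W t) α) (hlen : ∀ k, ∃ t, k ≤ (W t).length)
    (hq : ∀ t, RPath T (V t) (q t) (q (t + 1)) (b t)) (hb : ∃ᶠ t in atTop, b t = true) :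
    ∃ (r : ℕ → Q) (β : ℕ → Bool), r 0 = q 0 ∧ (∀ k, T (r k) (α k) (r (k + 1)) (β k)) ∧
      ∃ᶠ k in atTop, β k = true := by
  choose rs βs h0 h1 hT hβ using fun t => (hq t).exists_run
  have hl : ∀ t, (W (t + 1)).length = (W t).length + (V t).length := fun t => by
    rw [hW, List.length_append]
  have hmono : Monotone fun t => (W t).length :=
    monotone_nat_of_le_succ fun t => by simp only [hl]; omega
  -- `R t` is a run along `W t` with its marks; the next stage keeps it and appends the run of block
  -- `t`. Values beyond the current prefix are irrelevant.
  let R : ℕ → (ℕ → Q) × (ℕ → Bool) := fun t => Nat.rec (fun _ => q 0, fun _ => false)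
    (fun t x => (fun k => if k ≤ (W t).length then x.1 k else rs t (k - (W t).length),
      fun k => if k < (W t).length then x.2 k else βs t (k - (W t).length))) t
  have R1 : ∀ t k, (R (t + 1)).1 k =
      if k ≤ (W t).length then (R t).1 k else rs t (k - (W t).length) := fun _ _ => rfl
  have R2 : ∀ t k, (R (t + 1)).2 k =
      if k < (W t).length then (R t).2 k else βs t (k - (W t).length) := fun _ _ => rfl
  have Rend : ∀ t, (R t).1 (W t).length = q t := by
    intro t
    induction t with
    | zero => rfl
    | succ t ih =>
      rw [R1, hl]
      split_ifs with h
      -- Blocks may be empty; the block's run then starts and ends at the same state.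
      · have h2 : (V t).length = 0 := by omega
        rw [h2, Nat.add_zero, ih, ← h0 t, ← h1 t, h2]
      · rw [Nat.add_sub_cancel_left, h1]
  have Rrs : ∀ t j, (R (t + 1)).1 ((W t).length + j) = rs t j := by
    intro t j
    rw [R1]
    split_ifs with h
    · obtain rfl : j = 0 := by omega
      rw [Nat.add_zero, Rend, h0]
    · rw [Nat.add_sub_cancel_left]
  have Rβs : ∀ t j, (R (t + 1)).2 ((W t).length + j) = βs t j := by
    intro t j
    rw [R2, if_neg (by omega), Nat.add_sub_cancel_left]
  have RT : ∀ t k, k < (W t).length → T ((R t).1 k) (α k) ((R t).1 (k + 1)) ((R t).2 k) := by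
    intro t
    induction t with
    | zero => intro k hk; simp [hW0] at hk
    | succ t ih =>
      intro k hk
      rcases lt_or_ge k (W t).length with h | h
      · rw [R1, R1, R2, if_pos h.le, if_pos (Nat.succ_le_of_lt h), if_pos h]
        exact ih k h
      · obtain ⟨j, rfl⟩ := Nat.exists_eq_add_of_le h
        have hj : j < (V t).length := by rw [hl] at hk; omega
        have := hT t j hj
        rw [Nat.add_assoc, Rrs, Rrs, Rβs]
        convert this using 1
        have h3 := hα (t + 1) _ hk
        rw [← h3]
        simp [hW]
  have stab : ∀ t j k, (k ≤ (W t).length → (R (t + j)).1 k = (R t).1 k) ∧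
      (k < (W t).length → (R (t + j)).2 k = (R t).2 k) := by
    intro t j k
    induction j with
    | zero => exact ⟨fun _ => rfl, fun _ => rfl⟩
    | succ j ih =>
      have hm : (W t).length ≤ (W (t + j)).length := hmono (Nat.le_add_right t j)
      constructor
      · intro h
        rw [← Nat.add_assoc, R1, if_pos (h.trans hm), ih.1 h]
      · intro h
        rw [← Nat.add_assoc, R2, if_pos (h.trans_le hm), ih.2 h]
  -- The infinite run takes position `k` from a stage whose prefix already covers it; later stages
  -- do not change it.
  choose N hN using fun k => hlen (k + 1)
  have lim : ∀ t k, k < (W t).length →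
      (R (N k)).1 k = (R t).1 k ∧ (R (N k)).2 k = (R t).2 k := by
    intro t k h
    have hNk := hN k
    rcases le_total t (N k) with h' | h'
    · obtain ⟨j, hj⟩ := Nat.exists_eq_add_of_le h'
      rw [hj]
      exact ⟨(stab t j k).1 h.le, (stab t j k).2 h⟩
    · obtain ⟨j, rfl⟩ := Nat.exists_eq_add_of_le h'
      exact ⟨((stab _ j k).1 (by omega)).symm, ((stab _ j k).2 (by omega)).symm⟩
  refine ⟨fun k => (R (N k)).1 k, fun k => (R (N k)).2 k, ?_, fun k => ?_, ?_⟩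
  · have := (stab 0 (N 0) 0).1 (Nat.zero_le _)
    rw [Nat.zero_add] at this
    exact this
  · have h := hN (k + 1)
    have := RT (N (k + 1)) k (by omega)
    rwa [← (lim (N (k + 1)) k (by omega)).1, ← (lim (N (k + 1)) k (by omega)).2] at this
  · rw [Filter.frequently_atTop] at hb ⊢
    intro K
    obtain ⟨t₀, ht₀⟩ := hlen K
    obtain ⟨t, ht, hbt⟩ := hb t₀
    obtain ⟨j, hj, hj'⟩ := hβ t hbt
    have hm : (W t₀).length ≤ (W t).length := hmono ht
    refine ⟨(W t).length + j, by omega, ?_⟩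
    exact (lim (t + 1) _ (by rw [hl]; omega)).2.trans ((Rβs t j).trans hj')

/-- The paths labelled `s 0 (⋯ (s (t - 1) a))`, as marked transitions labelled `a`. -/
def levelTrans (T : Q → Γ → Q → Bool → Prop) (s : ℕ → Substitution Γ) (t : ℕ) :
    Q → Γ → Q → Bool → Prop := fun q a q' b => RPath T (iterList s t [a]) q q' b

theorem rpath_levelTrans (T : Q → Γ → Q → Bool → Prop) (s : ℕ → Substitution Γ) (t : ℕ)
    (u : List Γ) (q q' : Q) (b : Bool) :
    RPath (levelTrans T s t) u q q' b ↔ RPath T (iterList s t u) q q' b := by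
  rw [iterList_eq_flatMap, rpath_flatMap]
  rfl

/-- The next level's edges are paths along the current ones, so the history of the sequence need not
be remembered. -/
theorem levelTrans_succ (T : Q → Γ → Q → Bool → Prop) (s : ℕ → Substitution Γ) (t : ℕ)
    (q : Q) (a : Γ) (q' : Q) (b : Bool) :
    levelTrans T s (t + 1) q a q' b ↔ RPath (levelTrans T s t) ((s t).img a) q q' b := by
  rw [rpath_levelTrans, levelTrans, iterList_succ_singleton]

theorem levelTrans_zero (T : Q → Γ → Q → Bool → Prop) (s : ℕ → Substitution Γ)
    (q : Q) (a : Γ) (q' : Q) (b : Bool) : levelTrans T s 0 q a q' b ↔ T q a q' b := by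
  simp [levelTrans, iterList, RPath]

end Paths

/-! ### Several conditions to be met infinitely often -/

/-- One step of a counter that waits for the conditions `0, …, J - 1` in turn and is reset at
`J`. -/
def CounterStep (J k k' : ℕ) (c : Prop) : Prop :=
  k = J ∧ k' = 0 ∨ k < J ∧ k' = k ∨ k < J ∧ c ∧ k' = k + 1

/-- Between two visits to `J` the counter is reset to `0` and must step past `j`, which happens only
when condition `j` holds. -/
theorem frequently_of_counterStep {J : ℕ} {cond : ℕ → ℕ → Prop} {k : ℕ → ℕ}
    (hk : ∀ t, CounterStep J (k t) (k (t + 1)) (cond (k t) t)) (hJ : ∃ᶠ t in atTop, k t = J)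
    {j : ℕ} (hj : j < J) : ∃ᶠ t in atTop, cond j t := by
  rw [Filter.frequently_atTop] at hJ ⊢
  intro t₀
  by_contra! hc
  obtain ⟨t, ht, hkt⟩ := hJ t₀
  have h0 : k (t + 1) = 0 := by
    rcases hk t with h | h | h <;> omega
  have h1 : ∀ m, k (t + 1 + m) ≤ j := by
    intro m
    induction m with
    | zero => rw [Nat.add_zero, h0]; exact Nat.zero_le _
    | succ m ih =>
      have h2 := hk (t + 1 + m)
      rw [← Nat.add_assoc]
      rcases h2 with h | h | ⟨-, h, h'⟩
      · omega
      · omega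
      · rcases ih.lt_or_eq with h3 | h3
        · omega
        · rw [h3] at h
          exact absurd h (hc _ (by omega))
  obtain ⟨t', ht', hkt'⟩ := hJ (t + 1)
  obtain ⟨m, rfl⟩ := Nat.exists_eq_add_of_le ht'
  have := h1 m
  omega

/-- The counter that advances as soon as it may never gets stuck, because the condition awaited
recurs. -/
theorem exists_counter {J : ℕ} {cond : ℕ → ℕ → Prop}
    (h : ∀ j < J, ∃ᶠ t in atTop, cond j t) :
    ∃ k : ℕ → ℕ, k 0 = 0 ∧ (∀ t, k t ≤ J) ∧
      (∀ t, CounterStep J (k t) (k (t + 1)) (cond (k t) t)) ∧ ∃ᶠ t in atTop, k t = J := by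
  classical
  obtain ⟨k, k0, ks⟩ : ∃ k : ℕ → ℕ, k 0 = 0 ∧ ∀ t, k (t + 1) =
      if k t = J then 0 else if cond (k t) t then k t + 1 else k t :=
    ⟨fun t => Nat.rec 0 (fun t (x : ℕ) => if x = J then 0 else if cond x t then x + 1 else x) t,
      rfl, fun _ => rfl⟩
  have kle : ∀ t, k t ≤ J := by
    intro t
    induction t with
    | zero => rw [k0]; exact Nat.zero_le _
    | succ t ih => rw [ks]; split_ifs <;> omega
  refine ⟨k, k0, kle, fun t => ?_, ?_⟩
  · have := kle t
    rw [ks]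
    split_ifs with h1 h2
    · exact Or.inl ⟨h1, rfl⟩
    · exact Or.inr (Or.inr ⟨by omega, h2, rfl⟩)
    · exact Or.inr (Or.inl ⟨by omega, rfl⟩)
  · rw [Filter.frequently_atTop]
    intro t₀
    suffices H : ∀ j ≤ J, ∃ t ≥ t₀, k t = J ∨ j ≤ k t by
      obtain ⟨t, ht, h1⟩ := H J le_rfl
      have := kle t
      exact ⟨t, ht, by omega⟩
    intro j hj
    induction j with
    | zero => exact ⟨t₀, le_rfl, Or.inr (Nat.zero_le _)⟩
    | succ j ih =>
      obtain ⟨t, ht, h1⟩ := ih (by omega)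
      by_contra! hc
      have hstay : ∀ m, k (t + m) = j := by
        intro m
        induction m with
        | zero => have := hc t ht; rw [Nat.add_zero]; omega
        | succ m ih' =>
          have h2 := hc (t + m + 1) (by omega)
          have h3 := ks (t + m)
          rw [ih', if_neg (by omega)] at h3
          rw [← Nat.add_assoc]
          split_ifs at h3 <;> omega
      obtain ⟨t', ht', hc'⟩ := Filter.frequently_atTop.1 (h j (by omega)) t
      obtain ⟨m, rfl⟩ := Nat.exists_eq_add_of_le ht'
      have h3 := ks (t + m)
      rw [hstay m, if_neg (by omega), if_pos hc'] at h3
      have := hstay (m + 1)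
      rw [← Nat.add_assoc] at this
      omega

/-! ### Prefixes of directed words -/

section Directed

variable {Γ : Type} {s : ℕ → Substitution Γ} {a : ℕ → ℕ → Γ}

theorem img_head_cons_tail (ha : ∀ n, (s n).onInf (a (n + 1)) = a n) (t : ℕ) :
    (s t).img (a (t + 1) 0) = a t 0 :: ((s t).img (a (t + 1) 0)).tail := by
  obtain ⟨b, v, hb⟩ := List.exists_cons_of_ne_nil ((s t).nonerasing (a (t + 1) 0))
  have h := isPre_head_onInf (s t) (a (t + 1)) (b := b) (by rw [hb]; rfl)
  rw [ha] at h
  rw [h, hb]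
  rfl

theorem isPre_iterList_head (ha : ∀ n, (s n).onInf (a (n + 1)) = a n) (t : ℕ) :
    IsPre (iterList s t [a t 0]) (a 0) := by
  rw [eq_iterInf_of_chain ha t]
  refine isPre_iterInf s t fun k hk => ?_
  obtain rfl : k = 0 := by simpa using hk
  rfl

/-- The directed word is exhausted by these prefixes; the added block is a level-`t` image of a word
of length at most one here, and possibly empty, for the substitutions `λ_i` and `ρ_i`. -/
theorem iterList_head_succ (ha : ∀ n, (s n).onInf (a (n + 1)) = a n) (t : ℕ) :
    iterList s (t + 1) [a (t + 1) 0] =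
      iterList s t [a t 0] ++ iterList s t ((s t).img (a (t + 1) 0)).tail := by
  rw [iterList_succ_singleton, ← iterList_append, List.singleton_append, ← img_head_cons_tail ha]

end Directed

/-! ### The automaton on directive sequences -/

/-- The image of the letter `a` under the substitution with number `x`. -/
def imgNat (d x a : ℕ) : List ℕ :=
  if x < d then if a = x then [x] else [x, a] else if d + a = x then [a] else [a, x - d]

theorem imgNat_arNum {d : ℕ} (x : Fin d ⊕ Fin d) (a : Fin d) :
    imgNat d (arNum x) a = ((arSubst x).img a).map fun i : Fin d => (i : ℕ) := by
  rcases x with i | i <;> by_cases h : a = i <;>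
    simp [imgNat, arNum, arSubst, lambdaSubst, rhoSubst, h, Fin.val_inj]

/-- The pairs of states below `n` joined by a path labelled `u` along the marked edges in `G`, with
the marks of such paths. -/
def listPaths (n : ℕ) (G : List (ℕ × ℕ × ℕ × Bool)) (u : List ℕ) : List (ℕ × ℕ × Bool) :=
  u.foldr (fun a l => G.flatMap fun e => if e.2.1 = a then
    l.flatMap fun f => if e.2.2.1 = f.1 then [(e.1, f.2.1, e.2.2.2 || f.2.2)] else [] else [])
    ((List.range n).map fun q => (q, q, false))

/-- The bound on `q'` is needed because empty paths are listed only at states below `n`. -/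
theorem mem_listPaths {n : ℕ} {G : List (ℕ × ℕ × ℕ × Bool)} {u : List ℕ} {q q' : ℕ} {b : Bool}
    (hq' : q' < n) : (q, q', b) ∈ listPaths n G u ↔
      RPath (fun q a q' b => (q, a, q', b) ∈ G) u q q' b := by
  induction u generalizing q b with
  | nil =>
    simp only [listPaths, List.foldr_nil, List.mem_map, List.mem_range, Prod.mk.injEq, RPath]
    constructor
    · rintro ⟨p, -, rfl, rfl, rfl⟩
      exact ⟨rfl, rfl⟩
    · rintro ⟨rfl, rfl⟩
      exact ⟨q, hq', rfl, rfl, rfl⟩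
  | cons a u ih =>
    simp only [RPath, ← ih]
    rw [listPaths, List.foldr_cons, ← listPaths]
    simp only [List.mem_flatMap]
    constructor
    · rintro ⟨⟨q₁, a₁, p, b₁⟩, he, h⟩
      split_ifs at h with h1
      · obtain ⟨⟨p', q₂, b₂⟩, hf, h⟩ := List.mem_flatMap.1 h
        split_ifs at h with h2
        · simp only [List.mem_singleton, Prod.mk.injEq] at h h1 h2
          obtain ⟨rfl, rfl, rfl⟩ := h
          subst h1 h2
          exact ⟨p, b₁, b₂, he, hf, rfl⟩
        · simp at h
      · simp at h
    · rintro ⟨p, b₁, b₂, he, hf, rfl⟩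
      refine ⟨_, he, ?_⟩
      rw [if_pos rfl]
      refine List.mem_flatMap.2 ⟨_, hf, ?_⟩
      simp

/-- The conditions to be met infinitely often: each index occurs, some `λ_i` occurs, the run
visits an accepting state. -/
def LiftCond (d k x : ℕ) (b : Bool) : Prop :=
  k < d ∧ (x = k ∨ x = d + k) ∨ k = d ∧ x < d ∨ k = d + 1 ∧ b = true

/-- All possible marked edges `(q, a, q', b)`. -/
def allEdges (d n : ℕ) : List (ℕ × ℕ × ℕ × Bool) :=
  (List.range n).flatMap fun q => (List.range d).flatMap fun a => (List.range n).flatMap fun q' =>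
    [(q, a, q', false), (q, a, q', true)]

theorem mem_allEdges {d n q a q' : ℕ} {b : Bool} :
    (q, a, q', b) ∈ allEdges d n ↔ q < n ∧ a < d ∧ q' < n := by
  simp only [allEdges, List.mem_flatMap, List.mem_range, List.mem_cons, Prod.mk.injEq,
    List.not_mem_nil, or_false]
  constructor
  · rintro ⟨_, h1, _, h2, _, h3, ⟨rfl, rfl, rfl, -⟩ | ⟨rfl, rfl, rfl, -⟩⟩ <;>
      exact ⟨h1, h2, h3⟩
  · rintro ⟨h1, h2, h3⟩
    exact ⟨q, h1, a, h2, q', h3, by cases b <;> simp⟩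

/-- The states `(G, i, q, k)` of the automaton: known paths along images of letters, the first
letter of the current word, the state reached after the known prefix, the condition waited for. -/
def liftStates (d n : ℕ) : List (List (ℕ × ℕ × ℕ × Bool) × ℕ × ℕ × ℕ) :=
  (allEdges d n).sublists'.flatMap fun G => (List.range d).flatMap fun i =>
    (List.range n).flatMap fun q => (List.range (d + 3)).map fun k => (G, i, q, k)

theorem mem_liftStates {d n i q k : ℕ} {G : List (ℕ × ℕ × ℕ × Bool)} :
    (G, i, q, k) ∈ liftStates d n ↔ G.Sublist (allEdges d n) ∧ i < d ∧ q < n ∧ k < d + 3 := by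
  simp [liftStates]

/-- The initial states: the edges are transitions of `A`, and `q` is reached by the letter `i`. -/
def LiftInit (A : BuchiCode) (s : List (ℕ × ℕ × ℕ × Bool) × ℕ × ℕ × ℕ) : Prop :=
  s.2.2.2 = 0 ∧ (∀ e ∈ s.1, (e.1, e.2.1, e.2.2.1) ∈ A.2.2.1 ∧
    (e.2.2.2 = false ∨ e.2.2.1 ∈ A.2.2.2)) ∧ ∃ q₀ ∈ A.2.1, (q₀, s.2.1, s.2.2.1, false) ∈ s.1

/-- The transitions: the new edges are paths along the old ones, and `q` moves along the part of
the image of the new first letter that follows the old first letter. -/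
def LiftStep (d n : ℕ) (z : (List (ℕ × ℕ × ℕ × Bool) × ℕ × ℕ × ℕ) × ℕ ×
    (List (ℕ × ℕ × ℕ × Bool) × ℕ × ℕ × ℕ)) : Prop :=
  (∀ e ∈ z.2.2.1, (e.1, e.2.2.1, e.2.2.2) ∈ listPaths n z.1.1 (imgNat d z.2.1 e.2.1)) ∧
  (imgNat d z.2.1 z.2.2.2.1).head? = some z.1.2.1 ∧
  ∃ f ∈ listPaths n z.1.1 (imgNat d z.2.1 z.2.2.2.1).tail, f.1 = z.1.2.2.1 ∧
    f.2.1 = z.2.2.2.2.1 ∧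
    CounterStep (d + 2) z.1.2.2.2 z.2.2.2.2.2 (LiftCond d z.1.2.2.2 z.2.1 f.2.2)

/-! ### Correctness of the automaton -/

/-- The transitions of `A`; marked ones enter an accepting state. -/
def markedTrans (A : BuchiCode) {d : ℕ} (q : ℕ) (a : Fin d) (q' : ℕ) (b : Bool) : Prop :=
  q < A.1 ∧ q' < A.1 ∧ (q, (a : ℕ), q') ∈ A.2.2.1 ∧ (b = true → q' ∈ A.2.2.2)

/-- Acceptance is moved from states to the edges entering them. Marks may be omitted but not
invented, so infinitely many marks certify acceptance. -/
theorem accepts_iff_markedTrans {d : ℕ} (A : BuchiCode) (α : ℕ → Fin d) :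
    (A.toBuchi fun i : Fin d => (i : ℕ)).Accepts α ↔ ∃ (r : ℕ → ℕ) (β : ℕ → Bool),
      r 0 ∈ A.2.1 ∧ (∀ k, markedTrans A (r k) (α k) (r (k + 1)) (β k)) ∧
        ∃ᶠ k in atTop, β k = true := by
  classical
  rw [BuchiCode.accepts_iff]
  constructor
  · rintro ⟨r, hr, h0, h1, h2⟩
    refine ⟨r, fun k => decide (r (k + 1) ∈ A.2.2.2), h0,
      fun k => ⟨hr _, hr _, h1 k, of_decide_eq_true⟩, ?_⟩
    rw [Filter.frequently_atTop] at h2 ⊢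
    intro K
    obtain ⟨k, hk, hk'⟩ := h2 (K + 1)
    obtain ⟨j, rfl⟩ := Nat.exists_eq_add_of_le' (show 1 ≤ k by omega)
    exact ⟨j, by omega, decide_eq_true hk'⟩
  · rintro ⟨r, β, h0, h1, h2⟩
    refine ⟨r, fun n => (h1 n).1, h0, fun n => (h1 n).2.2.1, ?_⟩
    rw [Filter.frequently_atTop] at h2 ⊢
    intro K
    obtain ⟨k, hk, hk'⟩ := h2 K
    exact ⟨k + 1, by omega, (h1 k).2.2.2 hk'⟩

theorem rpath_markedTrans_lt {d : ℕ} {A : BuchiCode} {u : List (Fin d)} (hu : u ≠ []) {q q' : ℕ}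
    {b : Bool} (h : RPath (markedTrans A) u q q' b) : q < A.1 ∧ q' < A.1 := by
  induction u generalizing q b with
  | nil => exact absurd rfl hu
  | cons a u ih =>
    obtain ⟨p, b₁, b₂, h1, h2, -⟩ := h
    refine ⟨h1.1, ?_⟩
    by_cases hu' : u = []
    · subst hu'
      rw [← h2.1]
      exact h1.2.1
    · exact (ih hu' h2).2

theorem levelTrans_markedTrans_lt {d : ℕ} {A : BuchiCode} {s : ℕ → Substitution (Fin d)} {t : ℕ}
    {q q' : ℕ} {a : Fin d} {b : Bool} (h : levelTrans (markedTrans A) s t q a q' b) :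
    q < A.1 ∧ q' < A.1 := by
  refine rpath_markedTrans_lt (fun h' => ?_) h
  have := length_le_length_iterList s t [a]
  simp [h'] at this

theorem LiftCond.arIdx_eq {d : ℕ} {x : Fin d ⊕ Fin d} {b : Bool} {j : Fin d}
    (h : LiftCond d j (arNum x) b) : arIdx x = j := by
  have hj := j.2
  rcases x with i | i <;> have hi := i.2 <;> simp only [LiftCond, arNum, Sum.elim_inl,
    Sum.elim_inr] at h <;> apply Fin.ext <;> simp only [arIdx, Sum.elim_inl, Sum.elim_inr, id] <;>
    omega

theorem liftCond_arIdx {d : ℕ} (x : Fin d ⊕ Fin d) (b : Bool) :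
    LiftCond d (arIdx x) (arNum x) b := by
  rcases x with i | i
  · exact Or.inl ⟨i.2, Or.inl rfl⟩
  · exact Or.inl ⟨i.2, Or.inr rfl⟩

theorem arNum_lt_iff {d : ℕ} (x : Fin d ⊕ Fin d) : arNum x < d ↔ x.isLeft = true := by
  rcases x with i | i <;> simp [arNum]

theorem head?_img_arSubst {d : ℕ} (x : Fin d ⊕ Fin d) (a : Fin d) :
    ((arSubst x).img a).head? = some (if x.isLeft then arIdx x else a) := by
  rcases x with i | i <;> by_cases h : a = i <;>
    simp [arSubst, lambdaSubst, rhoSubst, arIdx, h]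

/-- The heads of the words in a chain are determined by those of the substitutions. -/
theorem eq_head_of_heads {d : ℕ} {w : ℕ → Fin d ⊕ Fin d} (hw : ∃ᶠ t in atTop, (w t).isLeft = true)
    {i j : ℕ → Fin d} (hi : ∀ t, ((arSubst (w t)).img (i (t + 1))).head? = some (i t))
    (hj : ∀ t, ((arSubst (w t)).img (j (t + 1))).head? = some (j t)) (t : ℕ) : i t = j t := by
  simp only [head?_img_arSubst, Option.some.injEq] at hi hj
  -- The next `λ_i` at or after `t` fixes the head at its position regardless of what follows;
  -- equality then propagates back to `t`.
  obtain ⟨t', ht', hw'⟩ := Filter.frequently_atTop.1 hw t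
  obtain ⟨m, rfl⟩ := Nat.exists_eq_add_of_le ht'
  clear ht'
  induction m generalizing t with
  | zero =>
    rw [Nat.add_zero] at hw'
    rw [← hi, ← hj, if_pos hw', if_pos hw']
  | succ m ih =>
    have := ih (t + 1) (by rwa [show t + 1 + m = t + (m + 1) by omega])
    rw [← hi, ← hj, this]

theorem mem_listPaths_imgNat {d n q q' : ℕ} {G : List (ℕ × ℕ × ℕ × Bool)} {u : List (Fin d)}
    {b : Bool} (hq' : q' < n) : (q, q', b) ∈ listPaths n G (u.map fun i : Fin d => (i : ℕ)) ↔
      RPath (fun q (a : Fin d) q' b => (q, (a : ℕ), q', b) ∈ G) u q q' b := by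
  rw [mem_listPaths hq', rpath_map]

/-- Soundness. The counter yields the recurrence conditions and hence the directed word; the stored
edges are genuine paths, which are concatenated into an accepting run. -/
theorem of_liftRun {d : ℕ} (hd : 2 ≤ d) (A : BuchiCode) (w : ℕ → Fin d ⊕ Fin d)
    {r : ℕ → List (ℕ × ℕ × ℕ × Bool) × ℕ × ℕ × ℕ} (hr : ∀ t, r t ∈ liftStates d A.1)
    (h0 : LiftInit A (r 0)) (h1 : ∀ t, LiftStep d A.1 (r t, arNum (w t), r (t + 1)))
    (h2 : ∃ᶠ t in atTop, (r t).2.2.2 = d + 2) :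
    WeaklyPrimitive (fun n => arSubst (w n)) ∧
      InfinitelyManyLeftProper (fun n => arSubst (w n)) ∧
      ∃ α : ℕ → Fin d, Directs (fun n => arSubst (w n)) α ∧
        (A.toBuchi fun i : Fin d => (i : ℕ)).Accepts α := by
  have : Nontrivial (Fin d) := Fin.nontrivial_iff_two_le.2 hd
  have hr' := fun t => mem_liftStates.1 (hr t)
  choose f hf hf1 hf2 hf3 using fun t => (h1 t).2.2
  have hcond := fun j hj => frequently_of_counterStep
    (cond := fun j t => LiftCond d j (arNum (w t)) (f t).2.2) hf3 h2 (j := j) hj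
  have hw : ∃ᶠ t in atTop, (w t).isLeft = true := by
    refine (hcond d (by omega)).mono fun t ht => ?_
    rw [← arNum_lt_iff]
    rcases ht with h | h | h <;> omega
  have hWP : WeaklyPrimitive (fun n => arSubst (w n)) :=
    (weaklyPrimitive_arSubst_iff hd w).2 fun i =>
      (hcond i (by omega)).mono fun t ht => ht.arIdx_eq
  have hLP : InfinitelyManyLeftProper (fun n => arSubst (w n)) :=
    hw.mono fun t ht => (leftProper_arSubst_iff hd _).2 ht
  have hb : ∃ᶠ t in atTop, (f t).2.2 = true := by
    refine (hcond (d + 1) (by omega)).mono fun t ht => ?_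
    rcases ht with h | h | h
    · omega
    · omega
    · exact h.2
  refine ⟨hWP, hLP, ?_⟩
  obtain ⟨α, ⟨a, rfl, ha⟩, -⟩ := existsUnique_directs hWP hLP
  refine ⟨a 0, ⟨a, rfl, ha⟩, ?_⟩
  have hhead : ∀ t, (r t).2.1 = (a t 0 : ℕ) := by
    intro t
    have := eq_head_of_heads hw (i := fun t => ⟨(r t).2.1, (hr' t).2.1⟩) (j := fun t => a t 0)
      (fun t => ?_) (fun t => ?_) t
    · exact congrArg Fin.val this
    · have h3 := (h1 t).2.1
      have h4 := imgNat_arNum (w t) ⟨(r (t + 1)).2.1, (hr' (t + 1)).2.1⟩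
      simp only at h3 h4
      rw [h4, List.head?_map, Option.map_eq_some_iff] at h3
      obtain ⟨c, hc, hc'⟩ := h3
      rw [hc, Option.some.injEq]
      exact Fin.ext hc'
    · exact congrArg List.head? (img_head_cons_tail ha t)
  have hG : ∀ t q (c : Fin d) q' b, (q, (c : ℕ), q', b) ∈ (r t).1 →
      levelTrans (markedTrans A) (fun n => arSubst (w n)) t q c q' b := by
    intro t
    induction t with
    | zero =>
      intro q c q' b h
      rw [levelTrans_zero]
      have h3 := mem_allEdges.1 ((hr' 0).1.subset h)
      have h4 := h0.2.1 _ h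
      refine ⟨h3.1, h3.2.2, h4.1, fun hb => ?_⟩
      rcases h4.2 with h5 | h5
      · exact absurd (h5.symm.trans hb) (by simp)
      · exact h5
    | succ t ih =>
      intro q c q' b h
      have h3 := mem_allEdges.1 ((hr' (t + 1)).1.subset h)
      have h4 := (h1 t).1 _ h
      simp only [imgNat_arNum] at h4
      rw [levelTrans_succ]
      exact ((mem_listPaths_imgNat h3.2.2).1 h4).mono ih
  obtain ⟨q₀, hq₀, hq₀'⟩ := h0.2.2
  -- Blocks are shifted by one: the first is the single letter `a 0 0`, read from `q₀` with mark
  -- `false`, and block `t + 1` is the extension from level `t` to level `t + 1`.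
  have hrun := exists_run_of_rpaths (T := markedTrans A) (α := a 0)
    (W := fun t => Nat.casesOn t [] fun t => iterList (fun n => arSubst (w n)) t [a t 0])
    (V := fun t => Nat.casesOn t [a 0 0] fun t =>
      iterList (fun n => arSubst (w n)) t ((arSubst (w t)).img (a (t + 1) 0)).tail)
    (q := fun t => Nat.casesOn t q₀ fun t => (r t).2.2.1)
    (b := fun t => Nat.casesOn t false fun t => (f t).2.2) rfl ?_ ?_ ?_ ?_ ?_
  · obtain ⟨ρ, β, hρ0, hρ, hβ⟩ := hrun
    exact (accepts_iff_markedTrans A _).2 ⟨ρ, β, by rw [hρ0]; exact hq₀, hρ, hβ⟩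
  · rintro (_ | t)
    · rfl
    · exact iterList_head_succ ha t
  · rintro (_ | t)
    · intro k hk
      simp at hk
    · exact isPre_iterList_head ha t
  · intro k
    obtain ⟨M, hM⟩ := hWP.exists_length_le k
    exact ⟨M + 1, hM M le_rfl _ (by simp)⟩
  · rintro (_ | t)
    · rw [hhead 0] at hq₀'
      exact hG 0 _ _ _ _ hq₀'
    · have h3 := hf t
      simp only at h3
      rw [hhead (t + 1), imgNat_arNum, ← List.map_tail, ← Prod.mk.eta (p := f t),
        ← Prod.mk.eta (p := (f t).2), hf1, hf2, mem_listPaths_imgNat (hr' (t + 1)).2.2.1] at h3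
      exact (rpath_levelTrans _ _ _ _ _ _ _).1 (h3.mono (hG t))
  · rw [Filter.frequently_atTop] at hb ⊢
    intro K
    obtain ⟨t, ht, ht'⟩ := hb K
    exact ⟨t + 1, by omega, ht'⟩

/-- Completeness. Store all true edges at every level, the true heads, and the states that the
accepting run of `A` visits at the ends of the prefixes `W t`. -/
theorem exists_liftRun {d : ℕ} (hd : 2 ≤ d) (A : BuchiCode) (w : ℕ → Fin d ⊕ Fin d)
    (hWP : WeaklyPrimitive (fun n => arSubst (w n)))
    (hLP : InfinitelyManyLeftProper (fun n => arSubst (w n))) {α : ℕ → Fin d}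
    (hα : Directs (fun n => arSubst (w n)) α)
    (hA : (A.toBuchi fun i : Fin d => (i : ℕ)).Accepts α) :
    ∃ r : ℕ → List (ℕ × ℕ × ℕ × Bool) × ℕ × ℕ × ℕ, (∀ t, r t ∈ liftStates d A.1) ∧
      LiftInit A (r 0) ∧ (∀ t, LiftStep d A.1 (r t, arNum (w t), r (t + 1))) ∧
      ∃ᶠ t in atTop, (r t).2.2.2 = d + 2 := by
  classical
  have : Nontrivial (Fin d) := Fin.nontrivial_iff_two_le.2 hd
  obtain ⟨a, rfl, ha⟩ := hα
  obtain ⟨r, β, hr0, hr, hβ⟩ := (accepts_iff_markedTrans A _).1 hA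
  set s : ℕ → Substitution (Fin d) := fun n => arSubst (w n) with hs
  let W : ℕ → List (Fin d) := fun t => iterList s t [a t 0]
  let V : ℕ → List (Fin d) := fun t => iterList s t ((s t).img (a (t + 1) 0)).tail
  have hW : ∀ t, W (t + 1) = W t ++ V t := iterList_head_succ ha
  have hl : ∀ t, (W (t + 1)).length = (W t).length + (V t).length := fun t => by
    rw [hW, List.length_append]
  have hlen : ∀ k, ∃ M, ∀ m ≥ M, k ≤ (W m).length := fun k => by
    obtain ⟨M, hM⟩ := hWP.exists_length_le k
    exact ⟨M, fun m hm => hM m hm _ (by simp)⟩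
  have hpath : ∀ t, ∃ b, RPath (markedTrans A) (V t) (r (W t).length) (r (W (t + 1)).length) b ∧
      ((∃ k < (V t).length, β ((W t).length + k) = true) → b = true) := by
    intro t
    rw [hl]
    refine exists_rpath_of_run (V t) (W t).length fun k hk => ?_
    have h1 := hr ((W t).length + k)
    have h2 := isPre_iterList_head ha (t + 1) ((W t).length + k)
      (by change _ < (W (t + 1)).length; rw [hl]; omega)
    rw [← h2] at h1
    convert h1 using 1
    change _ = (W (t + 1))[_]'_
    simp [hW]
  choose b hb hb' using hpath
  have hbf : ∃ᶠ t in atTop, b t = true := by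
    rw [Filter.frequently_atTop] at hβ ⊢
    intro K
    obtain ⟨k, hk, hk'⟩ := hβ (W K).length
    -- The least such `j` locates the block containing the marked position `k`; it is positive
    -- because `k` lies beyond `W K`.
    have hex : ∃ j, k < (W (K + j)).length := by
      obtain ⟨M, hM⟩ := hlen (k + 1)
      exact ⟨M, hM _ (by omega)⟩
    have h1 := Nat.find_spec hex
    have h2 := fun {m} => Nat.find_min hex (m := m)
    generalize Nat.find hex = j at h1 h2
    obtain _ | j := j
    · rw [Nat.add_zero] at h1
      omega
    · have h3 := h2 (Nat.lt_succ_self j)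
      refine ⟨K + j, by omega, hb' _ ⟨k - (W (K + j)).length, ?_, ?_⟩⟩
      · rw [← Nat.add_assoc, hl] at h1
        omega
      · rwa [show (W (K + j)).length + (k - (W (K + j)).length) = k by omega]
  have hcond : ∀ j < d + 2, ∃ᶠ t in atTop, LiftCond d j (arNum (w t)) (b t) := by
    intro j hj
    rcases lt_or_ge j d with h | h
    · refine ((weaklyPrimitive_arSubst_iff hd w).1 hWP ⟨j, h⟩).mono fun t ht => ?_
      have := liftCond_arIdx (w t) (b t)
      rwa [ht] at this
    · obtain rfl | rfl : j = d ∨ j = d + 1 := by omega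
      · refine hLP.mono fun t ht => Or.inr (Or.inl ⟨rfl, ?_⟩)
        rw [arNum_lt_iff]
        exact (leftProper_arSubst_iff hd _).1 ht
      · exact hbf.mono fun t ht => Or.inr (Or.inr ⟨rfl, ht⟩)
  obtain ⟨k, k0, kle, hk, hkJ⟩ := exists_counter hcond
  -- Filtering the fixed list `allEdges` gives a sublist, hence an admissible state component.
  let G : ℕ → List (ℕ × ℕ × ℕ × Bool) := fun t => (allEdges d A.1).filter fun e =>
    ∃ c : Fin d, (c : ℕ) = e.2.1 ∧ levelTrans (markedTrans A) s t e.1 c e.2.2.1 e.2.2.2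
  have hG : ∀ t q (c : Fin d) q' b, (q, (c : ℕ), q', b) ∈ G t ↔
      levelTrans (markedTrans A) s t q c q' b := by
    intro t q c q' b
    simp only [G, List.mem_filter, mem_allEdges, decide_eq_true_eq]
    constructor
    · rintro ⟨-, c', hc, h⟩
      rwa [← Fin.ext hc]
    · intro h
      have := levelTrans_markedTrans_lt h
      exact ⟨⟨this.1, c.2, this.2⟩, c, rfl, h⟩
  have hGex : ∀ t, ∀ e ∈ G t, ∃ (q : ℕ) (c : Fin d) (q' : ℕ) (b : Bool), e = (q, (c : ℕ), q', b) ∧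
      levelTrans (markedTrans A) s t q c q' b := by
    rintro t ⟨q, c, q', b⟩ he
    have h := (mem_allEdges.1 (List.mem_filter.1 he).1).2.1
    exact ⟨q, ⟨c, h⟩, q', b, rfl, (hG t q ⟨c, h⟩ q' b).1 he⟩
  refine ⟨fun t => (G t, a t 0, r (W t).length, k t), fun t => ?_, ⟨k0, ?_, ?_⟩,
    fun t => ⟨?_, ?_, ?_⟩, hkJ⟩
  · have := kle t
    exact mem_liftStates.2 ⟨List.filter_sublist, (a t 0).2, (hr _).1, by omega⟩
  · intro e he
    obtain ⟨q, c, q', b, rfl, h⟩ := hGex 0 e he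
    rw [levelTrans_zero] at h
    refine ⟨h.2.2.1, ?_⟩
    cases b
    · exact Or.inl rfl
    · exact Or.inr (h.2.2.2 rfl)
  · refine ⟨r 0, hr0, (hG _ _ _ _ _).2 ((levelTrans_zero _ _ _ _ _ _).2 ?_)⟩
    exact ⟨(hr 0).1, (hr 1).1, (hr 0).2.2.1, by simp⟩
  · intro e he
    obtain ⟨q, c, q', b, rfl, h⟩ := hGex (t + 1) e he
    have hlt := levelTrans_markedTrans_lt h
    simp only [imgNat_arNum]
    rw [mem_listPaths_imgNat hlt.2]
    rw [levelTrans_succ] at h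
    exact h.mono fun q a q' b => (hG t q a q' b).2
  · simp only [imgNat_arNum]
    change (((s t).img (a (t + 1) 0)).map _).head? = _
    rw [img_head_cons_tail ha]
    rfl
  · refine ⟨(r (W t).length, r (W (t + 1)).length, b t), ?_, rfl, rfl, hk t⟩
    simp only [imgNat_arNum]
    rw [← List.map_tail, mem_listPaths_imgNat (hr _).1]
    exact ((rpath_levelTrans _ _ _ _ _ _ _).2 (hb t)).mono fun q a q' b => (hG t q a q' b).2

/-! ### Primitive recursiveness of the construction -/

section Primrec

open Primrec

theorem PrimrecPred.forall_mem {α β : Type} [Primcodable α] [Primcodable β] {f : α → List β}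
    {R : α → β → Prop} (hf : Primrec f) (hR : PrimrecPred fun x : α × β => R x.1 x.2) :
    PrimrecPred fun a => ∀ b ∈ f a, R a b := by
  have hR' : PrimrecRel fun (b : β) (a : α) => R a b := hR.comp (pair snd fst)
  exact hR'.forall_mem_list.comp hf Primrec.id

theorem PrimrecPred.exists_mem {α β : Type} [Primcodable α] [Primcodable β] {f : α → List β}
    {R : α → β → Prop} (hf : Primrec f) (hR : PrimrecPred fun x : α × β => R x.1 x.2) :
    PrimrecPred fun a => ∃ b ∈ f a, R a b := by
  have hR' : PrimrecRel fun (b : β) (a : α) => R a b := hR.comp (pair snd fst)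
  exact hR'.exists_mem_list.comp hf Primrec.id

theorem Primrec.mem_list {α β : Type} [Primcodable α] [Primcodable β] {f : α → β}
    {g : α → List β} (hf : Primrec f) (hg : Primrec g) : PrimrecPred fun a => f a ∈ g a :=
  (PrimrecPred.exists_mem (R := fun a b => b = f a) hg
    (Primrec.eq.comp snd (hf.comp fst))).of_eq fun a => by simp

/-- The recursion for `sublists'` is a right fold. -/
theorem Primrec.list_sublists' {α : Type} [Primcodable α] :
    Primrec (List.sublists' : List α → List (List α)) := by
  have h : Primrec fun l : List α => l.foldr (fun a s => s ++ s.map (List.cons a)) [[]] := by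
    refine list_foldr (h := fun _ (x : α × List (List α)) => x.2 ++ x.2.map (List.cons x.1))
      Primrec.id (const [[]]) ?_
    exact list_append.comp (snd.comp snd) (list_map (snd.comp snd)
      (list_cons.comp (fst.comp (snd.comp fst)) snd))
  refine h.of_eq fun l => ?_
  induction l with
  | nil => rfl
  | cons a l ih => rw [List.foldr_cons, ih, List.sublists'_cons]

theorem primrec_imgNat : Primrec fun y : ℕ × ℕ × ℕ => imgNat y.1 y.2.1 y.2.2 := by
  have hx : Primrec fun y : ℕ × ℕ × ℕ => y.2.1 := fst.comp snd
  have ha : Primrec fun y : ℕ × ℕ × ℕ => y.2.2 := snd.comp snd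
  have single : ∀ {f : ℕ × ℕ × ℕ → ℕ}, Primrec f → Primrec fun y => [f y] :=
    fun hf => list_cons.comp hf (const [])
  exact ite (nat_lt.comp hx fst)
    (ite (Primrec.eq.comp ha hx) (single hx) (list_cons.comp hx (single ha)))
    (ite (Primrec.eq.comp (nat_add.comp fst ha) hx) (single ha)
      (list_cons.comp ha (single (nat_sub.comp hx fst))))

theorem primrec_listPaths : Primrec fun y : ℕ × List (ℕ × ℕ × ℕ × Bool) × List ℕ =>
    listPaths y.1 y.2.1 y.2.2 := by
  unfold listPaths
  refine list_foldr (h := fun (y : ℕ × List (ℕ × ℕ × ℕ × Bool) × List ℕ)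
    (x : ℕ × List (ℕ × ℕ × Bool)) => y.2.1.flatMap fun e =>
    if e.2.1 = x.1 then x.2.flatMap fun f =>
      if e.2.2.1 = f.1 then [(e.1, f.2.1, e.2.2.2 || f.2.2)] else [] else [])
    (snd.comp snd) (list_map (g := fun _ q => (q, q, false)) (list_range.comp fst)
      (pair snd (pair snd (const false)))) ?_
  refine list_flatMap (fst.comp (snd.comp fst)) (ite (Primrec.eq.comp
    (fst.comp (snd.comp snd)) (fst.comp (snd.comp fst)))
    (list_flatMap (snd.comp (snd.comp fst)) (ite (Primrec.eq.comp
      (fst.comp (snd.comp (snd.comp (snd.comp fst)))) (fst.comp snd)) ?_ (const []))) (const []))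
  exact list_cons.comp (pair (fst.comp (snd.comp fst)) (pair (fst.comp (snd.comp snd))
    (Primrec.or.comp (snd.comp (snd.comp (snd.comp (snd.comp fst))))
      (snd.comp (snd.comp snd))))) (const [])

theorem primrec_allEdges : Primrec fun p : ℕ × ℕ => allEdges p.1 p.2 := by
  have edge : ∀ b : Bool, Primrec fun x : (((ℕ × ℕ) × ℕ) × ℕ) × ℕ => (x.1.1.2, x.1.2, x.2, b) :=
    fun b =>
    pair (snd.comp (fst.comp fst)) (pair (snd.comp fst) (pair snd (const b)))
  have h1 : Primrec fun x : (ℕ × ℕ) × ℕ => List.range x.1.1 := list_range.comp (fst.comp fst)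
  have h2 : Primrec fun x : ((ℕ × ℕ) × ℕ) × ℕ => List.range x.1.1.2 :=
    list_range.comp (snd.comp (fst.comp fst))
  exact list_flatMap (list_range.comp snd) (list_flatMap h1 (list_flatMap h2
    (list_cons.comp (edge false) (list_cons.comp (edge true) (const [])))))

theorem primrec_liftStates : Primrec fun p : ℕ × ℕ => liftStates p.1 p.2 := by
  refine list_flatMap (list_sublists'.comp primrec_allEdges) (list_flatMap
    (list_range.comp (fst.comp fst)) (list_flatMap
      (list_range.comp (snd.comp (fst.comp fst))) (list_map (list_range.comp
        (nat_add.comp (fst.comp (fst.comp (fst.comp fst))) (const 3))) ?_)))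
  exact pair (snd.comp (fst.comp (fst.comp fst))) (pair (snd.comp (fst.comp fst))
    (pair (snd.comp fst) snd))

theorem primrecPred_counterStep {α : Type} [Primcodable α] {J k k' : α → ℕ} {c : α → Prop}
    (hJ : Primrec J) (hk : Primrec k) (hk' : Primrec k') (hc : PrimrecPred c) :
    PrimrecPred fun a => CounterStep (J a) (k a) (k' a) (c a) :=
  ((Primrec.eq.comp hk hJ).and (Primrec.eq.comp hk' (const 0))).or
    (((nat_lt.comp hk hJ).and (Primrec.eq.comp hk' hk)).or
      ((nat_lt.comp hk hJ).and (hc.and (Primrec.eq.comp hk' (succ.comp hk)))))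

theorem primrecPred_liftCond {α : Type} [Primcodable α] {d k x : α → ℕ} {b : α → Bool}
    (hd : Primrec d) (hk : Primrec k) (hx : Primrec x) (hb : Primrec b) :
    PrimrecPred fun a => LiftCond (d a) (k a) (x a) (b a) :=
  ((nat_lt.comp hk hd).and ((Primrec.eq.comp hx hk).or
    (Primrec.eq.comp hx (nat_add.comp hd hk)))).or
    (((Primrec.eq.comp hk hd).and (nat_lt.comp hx hd)).or
      ((Primrec.eq.comp hk (succ.comp hd)).and (Primrec.eq.comp hb (const true))))

theorem primrecPred_liftInit : PrimrecPred fun x : (ℕ × BuchiCode) ×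
    (List (ℕ × ℕ × ℕ × Bool) × ℕ × ℕ × ℕ) => LiftInit x.1.2 x.2 := by
  refine (Primrec.eq.comp (snd.comp (snd.comp (snd.comp snd))) (const 0)).and
    (PrimrecPred.and (PrimrecPred.forall_mem (fst.comp snd) (PrimrecPred.and ?_
      (PrimrecPred.or ?_ ?_))) (PrimrecPred.exists_mem
        (fst.comp (snd.comp (snd.comp fst))) ?_))
  · exact mem_list (pair (fst.comp snd) (pair (fst.comp (snd.comp snd))
      (fst.comp (snd.comp (snd.comp snd)))))
      (fst.comp (snd.comp (snd.comp (snd.comp (fst.comp fst)))))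
  · exact Primrec.eq.comp (snd.comp (snd.comp (snd.comp snd))) (const false)
  · exact mem_list (fst.comp (snd.comp (snd.comp snd)))
      (snd.comp (snd.comp (snd.comp (snd.comp (fst.comp fst)))))
  · exact mem_list (pair snd (pair (fst.comp (snd.comp (snd.comp fst)))
      (pair (fst.comp (snd.comp (snd.comp (snd.comp fst)))) (const false))))
      (fst.comp (snd.comp fst))

theorem primrecPred_liftStep : PrimrecPred fun x : (ℕ × BuchiCode) ×
    ((List (ℕ × ℕ × ℕ × Bool) × ℕ × ℕ × ℕ) × ℕ × (List (ℕ × ℕ × ℕ × Bool) × ℕ × ℕ × ℕ)) =>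
      LiftStep x.1.1 x.1.2.1 x.2 := by
  have paths : ∀ {α : Type} [Primcodable α] {n : α → ℕ} {G : α → List (ℕ × ℕ × ℕ × Bool)}
      {u : α → List ℕ}, Primrec n → Primrec G → Primrec u →
      Primrec fun a => listPaths (n a) (G a) (u a) :=
    fun hn hG hu => primrec_listPaths.comp (pair hn (pair hG hu))
  have img : ∀ {α : Type} [Primcodable α] {d x c : α → ℕ}, Primrec d → Primrec x → Primrec c →
      Primrec fun a => imgNat (d a) (x a) (c a) :=
    fun hd hx hc => primrec_imgNat.comp (pair hd (pair hx hc))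
  have hd := fst.comp (fst (α := ℕ × BuchiCode) (β := (List (ℕ × ℕ × ℕ × Bool) × ℕ × ℕ × ℕ) × ℕ ×
    (List (ℕ × ℕ × ℕ × Bool) × ℕ × ℕ × ℕ)))
  have hn := fst.comp (snd.comp (fst (α := ℕ × BuchiCode)
    (β := (List (ℕ × ℕ × ℕ × Bool) × ℕ × ℕ × ℕ) × ℕ ×
      (List (ℕ × ℕ × ℕ × Bool) × ℕ × ℕ × ℕ))))
  have hz := snd (α := ℕ × BuchiCode) (β := (List (ℕ × ℕ × ℕ × Bool) × ℕ × ℕ × ℕ) × ℕ ×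
    (List (ℕ × ℕ × ℕ × Bool) × ℕ × ℕ × ℕ))
  have hG := fst.comp (fst.comp hz)
  have hx := fst.comp (snd.comp hz)
  have hs' := snd.comp (snd.comp hz)
  have hi' := fst.comp (snd.comp hs')
  have himg := img hd hx hi'
  refine PrimrecPred.and (PrimrecPred.forall_mem (fst.comp hs') ?_) (PrimrecPred.and
    (Primrec.eq.comp (list_head?.comp himg)
      (option_some.comp (fst.comp (snd.comp (fst.comp hz)))))
    (PrimrecPred.exists_mem (paths hn hG (list_tail.comp himg)) (PrimrecPred.and ?_
      (PrimrecPred.and ?_ ?_))))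
  · exact mem_list (pair (fst.comp snd) (snd.comp (snd.comp snd)))
      (paths (hn.comp fst) (hG.comp fst) (img (hd.comp fst) (hx.comp fst)
        (fst.comp (snd.comp snd))))
  · exact Primrec.eq.comp (fst.comp snd)
      (fst.comp (snd.comp (snd.comp (fst.comp (hz.comp fst)))))
  · exact Primrec.eq.comp (fst.comp (snd.comp snd))
      (fst.comp (snd.comp (snd.comp (hs'.comp fst))))
  · have hk := snd.comp (snd.comp (snd.comp (fst.comp (hz.comp
      (fst (β := ℕ × ℕ × Bool))))))
    exact primrecPred_counterStep (nat_add.comp (hd.comp fst) (const 2)) hk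
      (snd.comp (snd.comp (snd.comp (hs'.comp fst))))
      (primrecPred_liftCond (hd.comp fst) hk (hx.comp fst) (snd.comp (snd.comp snd)))

end Primrec

/-! ### The final automaton and the theorem -/

/-- The automaton on directive sequences; over a one-letter alphabet it just simulates `A`. -/
noncomputable def directiveCode (p : ℕ × BuchiCode) : BuchiCode :=
  if p.1 = 1 then
    listCode (List.range p.2.1) 2 (fun q => q ∈ p.2.2.1) (fun q => q ∈ p.2.2.2.2)
      fun z => (z.1, 0, z.2.2) ∈ p.2.2.2.1
  else
    listCode (liftStates p.1 p.2.1) (2 * p.1) (LiftInit p.2) (fun s => s.2.2.2 = p.1 + 2)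
      (LiftStep p.1 p.2.1)

open Primrec in
theorem primrec_directiveCode : Primrec directiveCode := by
  refine ite (Primrec.eq.comp fst (const 1)) ?_ ?_
  · exact primrec_listCode (list_range.comp (fst.comp snd)) (const 2)
      (mem_list snd (fst.comp (snd.comp (snd.comp fst))))
      (mem_list snd (snd.comp (snd.comp (snd.comp (snd.comp fst)))))
      (mem_list (pair (fst.comp snd) (pair (const 0) (snd.comp (snd.comp snd))))
        (fst.comp (snd.comp (snd.comp (snd.comp fst)))))
  · exact primrec_listCode (primrec_liftStates.comp (pair fst (fst.comp snd)))
      (nat_mul.comp (const 2) fst) primrecPred_liftInit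
      (Primrec.eq.comp (snd.comp (snd.comp (snd.comp snd)))
        (nat_add.comp (fst.comp fst) (const 2))) primrecPred_liftStep

theorem arNum_lt {d : ℕ} (x : Fin d ⊕ Fin d) : arNum x < 2 * d := by
  rcases x with i | i <;> have := i.2 <;> simp only [arNum, Sum.elim_inl, Sum.elim_inr] <;> omega

/-- For `d = 1` every substitution is the identity, so `ρ_0` is left-proper too and images do not
grow. Both conditions on `w` are then automatic, and only the constant word has to be tested. -/
theorem directiveCode_accepts_iff {d : ℕ} (A : BuchiCode) (w : ℕ → Fin d ⊕ Fin d) :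
    ((directiveCode (d, A)).toBuchi arNum).Accepts w ↔
      WeaklyPrimitive (fun n => arSubst (w n)) ∧
        InfinitelyManyLeftProper (fun n => arSubst (w n)) ∧
        ∃ α : ℕ → Fin d, Directs (fun n => arSubst (w n)) α ∧
          (A.toBuchi fun i : Fin d => (i : ℕ)).Accepts α := by
  -- Over the empty alphabet there is no directive sequence.
  have hd0 : 0 < d := Sum.elim Fin.pos Fin.pos (w 0)
  by_cases hd : d = 1
  · subst hd
    have hWP : WeaklyPrimitive (fun n => arSubst (w n)) := fun n => ⟨0, fun c b =>
      (mem_img_arSubst _ _ _).2 (Or.inl (Subsingleton.elim _ _))⟩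
    have hLP : InfinitelyManyLeftProper (fun n => arSubst (w n)) :=
      Filter.Frequently.of_forall fun n => ⟨0, fun a => by
        rw [head?_img_arSubst]
        exact congrArg some (Subsingleton.elim _ _)⟩
    obtain ⟨α, hα, -⟩ := existsUnique_directs hWP hLP
    rw [show directiveCode (1, A) = _ from if_pos rfl,
      listCode_accepts_iff _ 2 _ _ _ _ arNum_lt]
    have h : (A.toBuchi fun i : Fin 1 => (i : ℕ)).Accepts α ↔ ∃ r : ℕ → ℕ, (∀ n, r n < A.1) ∧
        r 0 ∈ A.2.1 ∧ (∀ n, (r n, 0, r (n + 1)) ∈ A.2.2.1) ∧ ∃ᶠ n in atTop, r n ∈ A.2.2.2 := by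
      rw [BuchiCode.accepts_iff]
      simp only [Fin.val_eq_zero]
    simp only [List.mem_range, ← h]
    exact ⟨fun h => ⟨hWP, hLP, α, hα, h⟩,
      fun ⟨_, _, β, _, h⟩ => by rwa [Subsingleton.elim α β]⟩
  · have hd2 : 2 ≤ d := by omega
    rw [show directiveCode (d, A) = _ from if_neg hd, listCode_accepts_iff _ _ _ _ _ _ arNum_lt]
    exact ⟨fun ⟨r, hr, h0, h1, h2⟩ => of_liftRun hd2 A w hr h0 h1 h2,
      fun ⟨hWP, hLP, α, hα, hA⟩ => exists_liftRun hd2 A w hWP hLP hα hA⟩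

theorem mainTheorem5 :
    -- a weakly primitive sequence with infinitely many left-proper terms directs exactly one
    -- Arnoux-Rauzy word
    (∀ (d : ℕ) (w : ℕ → Fin d ⊕ Fin d),
      WeaklyPrimitive (fun n => arSubst (w n)) →
      InfinitelyManyLeftProper (fun n => arSubst (w n)) →
      ∃! α : ℕ → Fin d, IsArnouxRauzy α ∧ Directs (fun n => arSubst (w n)) α) ∧
    -- an automaton for the sequences whose Arnoux-Rauzy word lies in `L` is computable from `d`
    -- and an automaton for `L`
    ∃ C : ℕ × BuchiCode → BuchiCode, Computable C ∧
      ∀ (d : ℕ) (L : Set (ℕ → Fin d)) (A : BuchiCode),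
        (A.toBuchi (fun i : Fin d => (i : ℕ))).language = L →
        ∀ w : ℕ → Fin d ⊕ Fin d,
          ((C (d, A)).toBuchi arNum).Accepts w ↔
            WeaklyPrimitive (fun n => arSubst (w n)) ∧
            InfinitelyManyLeftProper (fun n => arSubst (w n)) ∧
            ∃ α : ℕ → Fin d, IsArnouxRauzy α ∧ Directs (fun n => arSubst (w n)) α ∧ α ∈ L := by
  constructor
  · intro d w hWP hLP
    have : Nonempty (Fin d) := ⟨arIdx (w 0)⟩
    obtain ⟨α, hα, huniq⟩ := existsUnique_directs hWP hLP
    exact ⟨α, ⟨⟨w, hWP, hLP, hα⟩, hα⟩, fun β hβ => huniq β hβ.2⟩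
  · refine ⟨directiveCode, primrec_directiveCode.to_comp, ?_⟩
    rintro d _ A rfl w
    rw [directiveCode_accepts_iff]
    -- The directed word is Arnoux-Rauzy with `w` itself as witness.
    exact ⟨fun ⟨hWP, hLP, α, hα, hA⟩ => ⟨hWP, hLP, α, ⟨w, hWP, hLP, hα⟩, hα, hA⟩,
      fun ⟨hWP, hLP, α, _, hα, hA⟩ => ⟨hWP, hLP, α, hα, hA⟩⟩
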